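/- Let $n\ge 0$ and let $V_n=H^0(\mathbb P^1,\mathcal O(n))\cong S^n(\mathbb C^2)^*$ be the space of complex binary forms of degree $n$. A length-$n$ (0-dimensional) subscheme $Z$ of $\mathbb P^1$ is the zero scheme of a nonzero form $f\in V_n$, unique up to scale, so that the length-$n$ subschemes are the points of $X=S^n\mathbb P^1=\mathbb P(V_n)$ (lines in $V_n$). The multiplicity of $Z$ at $p\in\mathbb P^1$ is the order of vanishing of $f$ at $p$ (it is $0$ if $p\notin Z$). Let $G=SL(2,\mathbb C)$ act on $X$ with the linearisation given by its natural action on $V_n$, $(g\cdot f)(z)=f(g^{-1}z)$, and hence on the spaces $H^0(X,\mathcal O(r))$ of homogeneous polynomial functions of degree $r$ on $V_n$. A point $x\in X$ is *semistable* if there are $r>0$ and $s\in H^0(X,\mathcal O(r))^G$ with $s(x)\neq 0$. A semistable point $x$ is *stable* if its stabiliser in $G$ is finite and the invariant sections separate orbits near $x$: for some $r>0$ there is $s\in H^0(X,\mathcal O(r))^G$ with $s(x)\ne0$ such that, on $U=\{s\neq0\}\subset X$, - for every $y\in U\setminus G\cdot x$ there is $t\in H^0(X,\mathcal O(r))^G$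 with $(t/s)(y)\neq (t/s)(x)$; - for every $v\in T_xX\setminus T_x(G\cdot x)$ there is $t\in H^0(X,\mathcal O(r))^G$ such that the function $t/s$ has, at $x$, a nonzero derivative of some order $m\geq1$ down $v$ (the $m$-th derivative at $\varepsilon=0$ of $t/s$ along $\varepsilon\mapsto[\tilde x+\varepsilon\tilde v]$, where $\tilde x\in V_n$ represents $x$ and $\tilde v\in V_n$ represents $v\in T_xX\cong V_n/\mathbb C\tilde x$). **Theorem.** A length-$n$ subscheme $Z$ of $\mathbb P^1$ is - semistable if and only if its multiplicity at every point of $\mathbb P^1$ is $\le n/2$; - stable if and only if its multiplicity at every point of $\mathbb P^1$ is $<n/2$. -/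

import Mathlib

open scoped LinearAlgebra.Projectivization MatrixGroups

noncomputable section

namespace GIT

/-! ### Linearised actions on a projective space

`G` acts linearly on a complex vector space `V`, hence on `ℙ ℂ V` (the space of lines in `V`), with
the tautological linearisation on `𝒪(-1)`, whose total space minus the zero section is
`V` minus the origin. -/

/-- `H⁰(ℙ(V), 𝒪(r))`: the homogeneous polynomial functions of degree `r` on `V`, that is,
homogeneous polynomial expressions of degree `r` in linear functionals on `V`. -/
def globalSections (V : Type*) [AddCommGroup V] [Module ℂ V] (r : ℕ) : Submodule ℂ (V → ℂ) where
  carrier := {s | ∃ P : MvPolynomial (Module.Dual ℂ V) ℂ, P.IsHomogeneous r ∧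
    ∀ v, s v = MvPolynomial.eval (fun φ => φ v) P}
  zero_mem' := ⟨0, MvPolynomial.isHomogeneous_zero _ _ _, fun v => by simp⟩
  add_mem' := by
    rintro s t ⟨P, hP, hs⟩ ⟨Q, hQ, ht⟩
    exact ⟨P + Q, hP.add hQ, fun v => by simp [hs, ht]⟩
  smul_mem' := by
    rintro c s ⟨P, hP, hs⟩
    exact ⟨MvPolynomial.C c * P, by simpa using (MvPolynomial.isHomogeneous_C _ c).mul hP,
      fun v => by simp [hs]⟩

/-- `H⁰(ℙ(V), 𝒪(r))^G`. -/
def invariantSections (G : Type*) [Group G] (V : Type*) [AddCommGroup V] [Module ℂ V]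
    [DistribMulAction G V] (r : ℕ) : Submodule ℂ (V → ℂ) where
  carrier := {s | s ∈ globalSections V r ∧ ∀ (g : G) (v : V), s (g • v) = s v}
  zero_mem' := ⟨Submodule.zero_mem _, fun _ _ => rfl⟩
  add_mem' := by
    rintro s t ⟨hs, hs'⟩ ⟨ht, ht'⟩
    exact ⟨Submodule.add_mem _ hs ht, fun g v => by simp [hs', ht']⟩
  smul_mem' := by
    rintro c s ⟨hs, hs'⟩
    exact ⟨Submodule.smul_mem _ c hs, fun g v => by simp [hs']⟩

section Stability

variable (G : Type*) [Group G] {V : Type*} [AddCommGroup V] [Module ℂ V]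
  [DistribMulAction G V] [SMulCommClass G ℂ V]

/-- A point is semistable if some invariant section of some `𝒪(r)`, `r > 0`, is nonzero at it. -/
def IsSemistable (x : ℙ ℂ V) : Prop :=
  ∃ r : ℕ, 0 < r ∧ ∃ s ∈ invariantSections G V r, s x.rep ≠ 0

/-- The vectors `v` of `V` whose class in `T_x ℙ(V) = V / ℂ x̃` (where `x̃ = x.rep`) is tangent to
the orbit `G • x`: every homogeneous polynomial that vanishes on the orbit vanishes to first
order at `x` in the direction `v`.  (An orbit is smooth and open in its Zariski closure, so its
tangent space is the Zariski tangent space of the closure.) -/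
def IsTangentToOrbit (x : ℙ ℂ V) (v : V) : Prop :=
  ∀ (d : ℕ), ∀ h ∈ globalSections V d, (∀ y ∈ MulAction.orbit G x, h y.rep = 0) →
    deriv (fun ε : ℂ => h (x.rep + ε • v)) 0 = 0

/-- A point `x` is stable if it is semistable, its stabiliser is finite, and the invariant sections
separate orbits near `x`: for some invariant section `s` of some `𝒪(r)`, `r > 0`, with
`s x ≠ 0`, the functions `t / s` on `U = {s ≠ 0}`, with `t` an invariant section of `𝒪(r)`,
distinguish `G • x` from every other orbit in `U`, and also do so infinitesimally: for every
tangent vector `v` at `x` that is not tangent to `G • x`, some `t / s` has a nonzero derivative, of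
some order `m ≥ 1`, down `v`.

The order `m` cannot be restricted to `1`: if the stabiliser of `x` acts nontrivially on the normal
space of the orbit, then first derivatives of all `t / s` vanish in some normal directions. -/
def IsStable (x : ℙ ℂ V) : Prop :=
  IsSemistable G x ∧
  (MulAction.stabilizer G x : Set G).Finite ∧
  ∃ r : ℕ, 0 < r ∧ ∃ s ∈ invariantSections G V r, s x.rep ≠ 0 ∧
    (∀ y : ℙ ℂ V, s y.rep ≠ 0 → y ∉ MulAction.orbit G x →
      ∃ t ∈ invariantSections G V r, t y.rep / s y.rep ≠ t x.rep / s x.rep) ∧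
    (∀ v : V, ¬ IsTangentToOrbit G x v →
      ∃ t ∈ invariantSections G V r, ∃ m : ℕ, 1 ≤ m ∧
        iteratedDeriv m (fun ε : ℂ => t (x.rep + ε • v) / s (x.rep + ε • v)) 0 ≠ 0)

end Stability

/-! ### Binary forms and points of the projective line -/

/-- `H⁰(ℙ¹, 𝒪(n)) = Sⁿ(ℂ²)^*`: binary forms of degree `n`. -/
abbrev BinaryForm (n : ℕ) : Type :=
  MvPolynomial.homogeneousSubmodule (Fin 2) ℂ n

/-- Substitution `f ↦ f ∘ A` of a `2 × 2` matrix in a polynomial in two variables. -/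
def subst (A : Matrix (Fin 2) (Fin 2) ℂ) :
    MvPolynomial (Fin 2) ℂ →ₐ[ℂ] MvPolynomial (Fin 2) ℂ :=
  MvPolynomial.aeval fun i => ∑ j, MvPolynomial.C (A i j) * MvPolynomial.X j

theorem eval_subst (A : Matrix (Fin 2) (Fin 2) ℂ) (f : MvPolynomial (Fin 2) ℂ)
    (z : Fin 2 → ℂ) :
    MvPolynomial.eval z (subst A f) = MvPolynomial.eval (A.mulVec z) f := by
  induction f using MvPolynomial.induction_on with
  | C a => simp [subst]
  | add p q hp hq => simp [hp, hq]
  | mul_X p i hp =>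
    rw [map_mul, map_mul, map_mul, hp]
    congr 1
    simp only [subst, MvPolynomial.aeval_X, map_sum, map_mul, MvPolynomial.eval_C,
      MvPolynomial.eval_X, Matrix.mulVec, dotProduct]

theorem subst_isHomogeneous (A : Matrix (Fin 2) (Fin 2) ℂ) {n : ℕ} {f : MvPolynomial (Fin 2) ℂ}
    (hf : f.IsHomogeneous n) : (subst A f).IsHomogeneous n := by
  have h := hf.aeval (fun i => ∑ j, MvPolynomial.C (A i j) * MvPolynomial.X j) (n := 1)
    (fun i => MvPolynomial.IsHomogeneous.sum _ _ _ fun j _ => by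
      simpa using (MvPolynomial.isHomogeneous_C (Fin 2) (A i j)).mul
        (MvPolynomial.isHomogeneous_X ℂ j))
  simpa [subst] using h

/-- The natural action of `SL(2, ℂ)` on binary forms, `(g • f)(z) = f(g⁻¹ z)`. -/
instance instActionBinaryForm (n : ℕ) : DistribMulAction SL(2, ℂ) (BinaryForm n) where
  smul g f := ⟨subst (g⁻¹).1 f.1, subst_isHomogeneous _ f.2⟩
  one_smul f := Subtype.ext <| MvPolynomial.funext fun z => by
    change MvPolynomial.eval z (subst ((1 : SL(2, ℂ))⁻¹).1 f.1) = _
    rw [eval_subst]; simp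
  mul_smul g h f := Subtype.ext <| MvPolynomial.funext fun z => by
    change MvPolynomial.eval z (subst ((g * h)⁻¹).1 f.1)
      = MvPolynomial.eval z (subst (g⁻¹).1 (subst (h⁻¹).1 f.1))
    rw [eval_subst, eval_subst, eval_subst, Matrix.mulVec_mulVec, mul_inv_rev]; rfl
  smul_zero g := Subtype.ext (map_zero (subst (g⁻¹).1))
  smul_add g f h := Subtype.ext (map_add (subst (g⁻¹).1) f.1 h.1)

theorem eval_smul {n : ℕ} (g : SL(2, ℂ)) (f : BinaryForm n) (z : Fin 2 → ℂ) :
    MvPolynomial.eval z (g • f).1 = MvPolynomial.eval ((g⁻¹).1.mulVec z) f.1 :=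
  eval_subst _ _ _

instance instCommBinaryForm (n : ℕ) : SMulCommClass SL(2, ℂ) ℂ (BinaryForm n) where
  smul_comm g c f := Subtype.ext (map_smul (subst (g⁻¹).1) c f.1)

/-- The length-`n` subschemes of `ℙ¹` over `ℂ`, i.e. `Sⁿℙ¹ = ℙ(H⁰(ℙ¹, 𝒪(n)))`: the zero schemes
of nonzero binary forms of degree `n`, each form being determined up to scale. -/
abbrev LengthSubscheme (n : ℕ) : Type :=
  ℙ ℂ (BinaryForm n)

/-- The linear form `b X - a Y`, whose only zero on `ℙ¹` is `p = [a : b]`. -/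
def linearFormAt (p : ℙ ℂ (Fin 2 → ℂ)) : MvPolynomial (Fin 2) ℂ :=
  MvPolynomial.C (p.rep 1) * MvPolynomial.X 0 - MvPolynomial.C (p.rep 0) * MvPolynomial.X 1

/-- The multiplicity of the subscheme `Z` at the point `p` of `ℙ¹`: the order of vanishing at `p`
of the form that cuts out `Z`. -/
def multiplicityAt {n : ℕ} (Z : LengthSubscheme n) (p : ℙ ℂ (Fin 2 → ℂ)) : ℕ :=
  multiplicity (linearFormAt p) Z.rep.1

end GIT

end

noncomputable section

namespace GIT

/-! ### Brackets and products of linear forms -/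

/-! Write a form of degree `n > 0` as `∏ [·, aᵢ]` with `aᵢ ∈ ℂ²`. The multiplicity at a point of
`ℙ¹` is then the number of `aᵢ` on that line, and a symmetric bracket polynomial of equal degree in
all the `aᵢ` is an invariant. The proof needs only the monomials `∏ᵢ [aᵢ, a_{π i}]`, collected in a
vector `permBracket a` indexed by the permutations `π`. For every linear functional `ℓ` the norm
`∏_σ ℓ (permBracket (a ∘ σ))` is an invariant section (`exists_invariantSection_prod_dual`).

If all multiplicities are at most `n / 2`, Hall's theorem gives a `π` that sends each `i` to an
index with nonproportional vector. So `permBracket a ≠ 0`, and a generic `ℓ` gives an invariant that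
is nonzero at the form. If they are less than `n / 2`, Hall's condition has slack, and one or two
values of `π` can be prescribed. Quotients of monomials then give the cross-ratios of the zeros, so
that `permBracket a` up to scale determines the orbit in `ℙ` (`exists_smul_formOfPoints_eq`). An `ℓ`
that kills `permBracket b` but no `permBracket (a ∘ σ)` separates the orbit of `a` from `b`. The
stabiliser is finite because there are three distinct zeros. Infinitesimal separation is automatic:
by analyticity, a line to which all `t / s` are blind stays, near `x`, inside the orbit.

Conversely, let the line of `v` have multiplicity `m ≥ n / 2`. A torus scaling `v` by `t` and a
complement by `t⁻¹` yields `s(f) = t^((2m - n) r) s(f_t)`, where `f_t` has a limit as `t → 0`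
(`invariantSection_eq_limit`). For `2m > n` every invariant of positive degree vanishes at `f`. For
`2m = n` the invariants do not distinguish `f` from its limit; stability would put the limit in the
orbit of `f`, but the torus fixes the limit in `ℙ`, so stabilisers in that orbit are infinite. -/

/-- The bracket `[a, b]`, that is, the determinant of two vectors of `ℂ²`. -/
def bracket (a b : Fin 2 → ℂ) : ℂ := a 0 * b 1 - a 1 * b 0

theorem bracket_swap (a b : Fin 2 → ℂ) : bracket a b = -bracket b a := by
  simp only [bracket]; ring

theorem bracket_self (a : Fin 2 → ℂ) : bracket a a = 0 := by
  simp only [bracket]; ring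

theorem bracket_smul_left (c : ℂ) (a b : Fin 2 → ℂ) : bracket (c • a) b = c * bracket a b := by
  simp only [bracket, Pi.smul_apply, smul_eq_mul]; ring

theorem bracket_smul_right (c : ℂ) (a b : Fin 2 → ℂ) : bracket a (c • b) = c * bracket a b := by
  simp only [bracket, Pi.smul_apply, smul_eq_mul]; ring

theorem bracket_mulVec (A : Matrix (Fin 2) (Fin 2) ℂ) (a b : Fin 2 → ℂ) :
    bracket (A.mulVec a) (A.mulVec b) = A.det * bracket a b := by
  simp only [bracket, Matrix.mulVec, dotProduct, Fin.sum_univ_two, Matrix.det_fin_two]; ring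

theorem exists_eq_smul_of_bracket_eq_zero {a b : Fin 2 → ℂ} (ha : a ≠ 0) (h : bracket a b = 0) :
    ∃ c : ℂ, b = c • a := by
  simp only [bracket] at h
  by_cases h0 : a 0 = 0
  · have h1 : a 1 ≠ 0 := fun h1 => ha (by ext i; fin_cases i <;> simp [h0, h1])
    refine ⟨b 1 / a 1, ?_⟩
    ext i; fin_cases i
    · have : b 0 = 0 := by simpa [h0, h1] using h
      simp [h0, this]
    · simp [h1]
  · refine ⟨b 0 / a 0, ?_⟩
    ext i; fin_cases i
    · simp [h0]
    · simp only [Fin.mk_one, Pi.smul_apply, smul_eq_mul]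
      field_simp
      linear_combination h

theorem bracket_trans {a b c : Fin 2 → ℂ} (hb : b ≠ 0) (hab : bracket a b = 0)
    (hbc : bracket b c = 0) : bracket a c = 0 := by
  obtain ⟨r, rfl⟩ := exists_eq_smul_of_bracket_eq_zero hb hbc
  rw [bracket_smul_right, hab, mul_zero]

/-- The linear form `z ↦ [z, a]`, whose zero on `ℙ¹` is `[a]`. -/
def linForm (a : Fin 2 → ℂ) : MvPolynomial (Fin 2) ℂ :=
  MvPolynomial.C (a 1) * MvPolynomial.X 0 - MvPolynomial.C (a 0) * MvPolynomial.X 1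

theorem eval_linForm (a z : Fin 2 → ℂ) : MvPolynomial.eval z (linForm a) = bracket z a := by
  simp [linForm, bracket]; ring

theorem linForm_isHomogeneous (a : Fin 2 → ℂ) : (linForm a).IsHomogeneous 1 :=
  (MvPolynomial.isHomogeneous_C_mul_X _ _).sub (MvPolynomial.isHomogeneous_C_mul_X _ _)

theorem linForm_smul (c : ℂ) (a : Fin 2 → ℂ) : linForm (c • a) = MvPolynomial.C c * linForm a := by
  simp only [linForm, Pi.smul_apply, smul_eq_mul, map_mul]; ring

theorem linForm_zero : linForm 0 = 0 := by simp [linForm]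

theorem linForm_ne_zero {a : Fin 2 → ℂ} (ha : a ≠ 0) : linForm a ≠ 0 := by
  intro h
  apply ha
  have h1 := eval_linForm a ![1, 0]
  have h0 := eval_linForm a ![0, 1]
  rw [h] at h0 h1
  simp [bracket] at h0 h1
  ext i; fin_cases i
  · exact h0
  · exact h1.symm

/-- The binary form `∏ [·, aᵢ]`. -/
def formOfPoints {n : ℕ} (a : Fin n → Fin 2 → ℂ) : BinaryForm n :=
  ⟨∏ i, linForm (a i), by
    simpa using MvPolynomial.IsHomogeneous.prod Finset.univ (fun i => linForm (a i)) (fun _ => 1)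
      fun i _ => linForm_isHomogeneous (a i)⟩

theorem eval_formOfPoints {n : ℕ} (a : Fin n → Fin 2 → ℂ) (z : Fin 2 → ℂ) :
    MvPolynomial.eval z (formOfPoints a).1 = ∏ i, bracket z (a i) := by
  simp [formOfPoints, map_prod, eval_linForm]

theorem smul_formOfPoints {n : ℕ} (g : SL(2, ℂ)) (a : Fin n → Fin 2 → ℂ) :
    g • formOfPoints a = formOfPoints fun i => g.1.mulVec (a i) := by
  refine Subtype.ext <| MvPolynomial.funext fun z => ?_
  rw [eval_smul, eval_formOfPoints, eval_formOfPoints]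
  refine Finset.prod_congr rfl fun i _ => ?_
  have h := bracket_mulVec g.1 ((g⁻¹).1.mulVec z) (a i)
  rw [Matrix.mulVec_mulVec, ← Matrix.SpecialLinearGroup.coe_mul, mul_inv_cancel] at h
  simpa using h.symm

theorem formOfPoints_smul {n : ℕ} (c : Fin n → ℂ) (a : Fin n → Fin 2 → ℂ) :
    (formOfPoints fun i => c i • a i) = (∏ i, c i) • formOfPoints a := by
  refine Subtype.ext <| MvPolynomial.funext fun z => ?_
  rw [eval_formOfPoints]
  simp [bracket_smul_right, Finset.prod_mul_distrib, MvPolynomial.smul_eval, eval_formOfPoints]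

theorem formOfPoints_comp {n : ℕ} (a : Fin n → Fin 2 → ℂ) (σ : Equiv.Perm (Fin n)) :
    (formOfPoints fun i => a (σ i)) = formOfPoints a :=
  Subtype.ext <| Equiv.prod_comp σ fun i => linForm (a i)

theorem formOfPoints_ne_zero_iff {n : ℕ} {a : Fin n → Fin 2 → ℂ} :
    formOfPoints a ≠ 0 ↔ ∀ i, a i ≠ 0 := by
  rw [← not_iff_not, not_not]
  push Not
  rw [← Subtype.val_inj]
  simp only [formOfPoints, ZeroMemClass.coe_zero, Finset.prod_eq_zero_iff, Finset.mem_univ,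
    true_and]
  refine exists_congr fun i => ⟨fun h => ?_, fun h => by rw [h, linForm_zero]⟩
  by_contra h'
  exact linForm_ne_zero h' h

/-! ### Factorisation of binary forms over `ℂ`. -/

theorem eval_smul_of_isHomogeneous {n : ℕ} {f : MvPolynomial (Fin 2) ℂ} (hf : f.IsHomogeneous n)
    (c : ℂ) (z : Fin 2 → ℂ) :
    MvPolynomial.eval (c • z) f = c ^ n * MvPolynomial.eval z f := by
  rw [MvPolynomial.eval_eq, MvPolynomial.eval_eq, Finset.mul_sum]
  refine Finset.sum_congr rfl fun d hd => ?_
  have hdeg : ∑ i ∈ d.support, d i = n := by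
    have := hf.degree_eq_sum_deg_support hd
    simpa [Finsupp.degree] using this.symm
  simp only [Pi.smul_apply, smul_eq_mul, mul_pow, Finset.prod_mul_distrib]
  rw [Finset.prod_pow_eq_pow_sum, hdeg]
  ring

/-- Homogeneous binary forms that agree at the points `(t, 1)` are equal. -/
theorem eq_of_eval_affine_eq {n : ℕ} {f g : MvPolynomial (Fin 2) ℂ} (hf : f.IsHomogeneous n)
    (hg : g.IsHomogeneous n)
    (h : ∀ t : ℂ, MvPolynomial.eval ![t, 1] f = MvPolynomial.eval ![t, 1] g) : f = g := by
  have hX : (MvPolynomial.X 1 : MvPolynomial (Fin 2) ℂ) ≠ 0 := MvPolynomial.X_ne_zero 1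
  -- The factor `X 1` makes both sides vanish where `z 1 = 0`; every other point is a multiple of
  -- some `(t, 1)`.
  refine mul_left_cancel₀ hX (MvPolynomial.funext fun z => ?_)
  simp only [map_mul, MvPolynomial.eval_X]
  by_cases hz : z 1 = 0
  · simp [hz]
  · have : z = z 1 • ![z 0 / z 1, 1] := by
      ext i; fin_cases i
      · simp [mul_div_cancel₀ _ hz]
      · simp
    rw [this, eval_smul_of_isHomogeneous hf, eval_smul_of_isHomogeneous hg, h]

theorem exists_map_univ_eq_of_card_eq {α : Type*} (m : Multiset α) {n : ℕ} (h : m.card = n) :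
    ∃ a : Fin n → α, Finset.univ.val.map a = m := by
  obtain ⟨l, rfl⟩ := Quot.exists_rep m
  obtain rfl : l.length = n := h
  exact ⟨l.get, (Fin.univ_val_map l.get).trans (congrArg _ (List.ofFn_get l))⟩

/-- A binary form over `ℂ` is a product of linear forms. -/
theorem exists_eq_C_mul_prod_linForm {n : ℕ} {f : MvPolynomial (Fin 2) ℂ}
    (hf : f.IsHomogeneous n) :
    ∃ (c : ℂ) (a : Fin n → Fin 2 → ℂ), (∀ i, a i ≠ 0) ∧
      f = MvPolynomial.C c * ∏ i, linForm (a i) := by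
  set p : Polynomial ℂ := MvPolynomial.aeval ![Polynomial.X, 1] f with hp
  have hpe : ∀ t, p.eval t = MvPolynomial.eval ![t, 1] f := by
    intro t
    have : (Polynomial.aeval t).comp (MvPolynomial.aeval ![Polynomial.X, 1])
        = MvPolynomial.aeval (R := ℂ) ![t, 1] := by
      ext i; fin_cases i <;> simp
    have := DFunLike.congr_fun this f
    simpa [Polynomial.coe_aeval_eq_eval, MvPolynomial.coe_aeval_eq_eval] using this
  have hdeg : p.natDegree ≤ n := by
    rw [hp, MvPolynomial.aeval_def, MvPolynomial.eval₂_eq]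
    refine Polynomial.natDegree_sum_le_of_forall_le _ _ fun d hd => ?_
    have h1 : d.degree = n := (hf.degree_eq_sum_deg_support hd).symm
    have h2 : d 0 + d 1 = n := by
      rw [← h1, Finsupp.degree_eq_sum, Fin.sum_univ_two]
    have h3 : ∏ i ∈ d.support, (![Polynomial.X, 1] : Fin 2 → Polynomial ℂ) i ^ d i
        = Polynomial.X ^ d 0 := by
      rw [Finset.prod_subset (Finset.subset_univ _) (fun i _ hi => by
        rw [Finsupp.notMem_support_iff.mp hi, pow_zero]), Fin.prod_univ_two]
      simp
    rw [h3]
    refine (Polynomial.natDegree_C_mul_X_pow_le _ _).trans ?_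
    omega
  have hsplit := IsAlgClosed.splits p
  -- The degree lost in dehomogenising is the multiplicity at infinity. The representative `(-1, 0)`
  -- has linear form exactly `X 1`, with value `1` at `(t, 1)`, so no sign has to be corrected.
  set m : Multiset (Fin 2 → ℂ) :=
    p.roots.map (fun t => ![t, 1]) + Multiset.replicate (n - p.roots.card) ![-1, 0] with hm
  have hcard : m.card = n := by
    have := p.card_roots'
    simp [hm]; omega
  have hm0 : ∀ a ∈ m, a ≠ 0 := by
    intro a ha h0
    rw [hm, Multiset.mem_add, Multiset.mem_map] at ha
    rcases ha with ⟨t, -, rfl⟩ | ha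
    · simpa using congrFun h0 1
    · rw [Multiset.eq_of_mem_replicate ha] at h0
      simpa using congrFun h0 0
  obtain ⟨a, ha⟩ := exists_map_univ_eq_of_card_eq m hcard
  refine ⟨p.leadingCoeff, a, fun i => hm0 _ ?_, ?_⟩
  · rw [← ha]
    exact Multiset.mem_map_of_mem a (Finset.mem_univ_val i)
  have hprod : ∏ i, linForm (a i) = (m.map linForm).prod := by
    rw [← ha, Multiset.map_map]; rfl
  rw [hprod]
  have hhom : (m.map linForm).prod.IsHomogeneous n := by
    rw [← hprod]
    simpa using MvPolynomial.IsHomogeneous.prod Finset.univ _ (fun _ => 1)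
      fun i _ => linForm_isHomogeneous (a i)
  refine eq_of_eval_affine_eq hf (hhom.C_mul _) fun t => ?_
  rw [← hpe]
  conv_lhs => rw [hsplit.eq_prod_roots]
  rw [Polynomial.eval_mul, Polynomial.eval_C, Polynomial.eval_multiset_prod, map_mul,
    MvPolynomial.eval_C, hm]
  simp [Multiset.map_map, eval_linForm, bracket, map_multiset_prod]

theorem exists_eq_formOfPoints {n : ℕ} (hn : 0 < n) (f : BinaryForm n) :
    ∃ a : Fin n → Fin 2 → ℂ, f = formOfPoints a := by
  obtain ⟨c, a, -, h⟩ := exists_eq_C_mul_prod_linForm f.2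
  -- The scalar is absorbed into one of the vectors, which requires `n > 0`.
  refine ⟨fun i => (if i = ⟨0, hn⟩ then c else 1) • a i, ?_⟩
  rw [formOfPoints_smul, Finset.prod_ite_eq' Finset.univ]
  refine Subtype.ext ?_
  simp [h, formOfPoints, MvPolynomial.smul_eq_C_mul]

/-! ### Sections of `𝒪(r)` -/

theorem globalSections_mul_mem {V : Type*} [AddCommGroup V] [Module ℂ V] {r r' : ℕ} {s t : V → ℂ}
    (hs : s ∈ globalSections V r) (ht : t ∈ globalSections V r') :
    (fun v => s v * t v) ∈ globalSections V (r + r') := by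
  obtain ⟨P, hP, hs⟩ := hs
  obtain ⟨Q, hQ, ht⟩ := ht
  exact ⟨P * Q, hP.mul hQ, fun v => by simp [hs, ht]⟩

theorem globalSections_prod_mem {V : Type*} [AddCommGroup V] [Module ℂ V] {ι : Type*}
    (S : Finset ι) (s : ι → V → ℂ) (r : ι → ℕ) (hs : ∀ i ∈ S, s i ∈ globalSections V (r i)) :
    (fun v => ∏ i ∈ S, s i v) ∈ globalSections V (∑ i ∈ S, r i) := by
  classical
  induction S using Finset.induction_on with
  | empty => exact ⟨1, MvPolynomial.isHomogeneous_one _ _, fun v => by simp⟩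
  | insert i S hi ih =>
    simp only [Finset.prod_insert hi, Finset.sum_insert hi]
    exact globalSections_mul_mem (hs i (Finset.mem_insert_self _ _))
      (ih fun j hj => hs j (Finset.mem_insert_of_mem hj))

theorem dual_mem_globalSections {V : Type*} [AddCommGroup V] [Module ℂ V]
    (φ : Module.Dual ℂ V) : (fun v => φ v) ∈ globalSections V 1 :=
  ⟨MvPolynomial.X φ, MvPolynomial.isHomogeneous_X _ _, fun v => by simp⟩

theorem globalSections_smul_apply {V : Type*} [AddCommGroup V] [Module ℂ V] {r : ℕ} {s : V → ℂ}
    (hs : s ∈ globalSections V r) (c : ℂ) (v : V) : s (c • v) = c ^ r * s v := by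
  obtain ⟨P, hP, hs⟩ := hs
  rw [hs, hs, MvPolynomial.eval_eq, MvPolynomial.eval_eq, Finset.mul_sum]
  refine Finset.sum_congr rfl fun d hd => ?_
  have hdeg : ∑ i ∈ d.support, d i = r := by
    have := hP.degree_eq_sum_deg_support hd
    simpa [Finsupp.degree] using this.symm
  simp only [map_smul, smul_eq_mul, mul_pow, Finset.prod_mul_distrib]
  rw [Finset.prod_pow_eq_pow_sum, hdeg]
  ring

theorem eval_mem_globalSections {n : ℕ} (z : Fin 2 → ℂ) :
    (fun f : BinaryForm n => MvPolynomial.eval z f.1) ∈ globalSections (BinaryForm n) 1 :=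
  dual_mem_globalSections
    ((MvPolynomial.aeval (R := ℂ) z).toLinearMap.comp (Submodule.subtype _))

/-! ### Multihomogeneous functions of `n` points -/

/-- The functions on `(ℂ²)ⁿ` that are polynomial, homogeneous of degree `d i` in the `i`-th
vector. -/
def multiHomogeneous {n : ℕ} (d : Fin n → ℕ) : Submodule ℂ ((Fin n → Fin 2 → ℂ) → ℂ) :=
  Submodule.span ℂ {Φ | ∃ w : Fin n → MvPolynomial (Fin 2) ℂ, (∀ i, (w i).IsHomogeneous (d i)) ∧
    Φ = fun a => ∏ i, MvPolynomial.eval (a i) (w i)}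

theorem multiHomogeneous_mul_mem {n : ℕ} {d e : Fin n → ℕ} {Φ Ψ : (Fin n → Fin 2 → ℂ) → ℂ}
    (hΦ : Φ ∈ multiHomogeneous d) (hΨ : Ψ ∈ multiHomogeneous e) :
    Φ * Ψ ∈ multiHomogeneous (d + e) := by
  induction hΦ using Submodule.span_induction with
  | zero => rw [zero_mul]; exact Submodule.zero_mem _
  | add Φ Φ' _ _ h h' => rw [add_mul]; exact Submodule.add_mem _ h h'
  | smul c Φ _ h => rw [smul_mul_assoc]; exact Submodule.smul_mem _ _ h
  | mem Φ hΦ =>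
    obtain ⟨w, hw, rfl⟩ := hΦ
    induction hΨ using Submodule.span_induction with
    | zero => rw [mul_zero]; exact Submodule.zero_mem _
    | add Φ Φ' _ _ h h' => rw [mul_add]; exact Submodule.add_mem _ h h'
    | smul c Φ _ h => rw [mul_smul_comm]; exact Submodule.smul_mem _ _ h
    | mem Ψ hΨ =>
      obtain ⟨w', hw', rfl⟩ := hΨ
      refine Submodule.subset_span ⟨fun i => w i * w' i, fun i => (hw i).mul (hw' i), ?_⟩
      funext a
      simp [Finset.prod_mul_distrib]

theorem one_mem_multiHomogeneous {n : ℕ} : 1 ∈ multiHomogeneous (0 : Fin n → ℕ) :=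
  Submodule.subset_span
    ⟨fun _ => 1, fun _ => MvPolynomial.isHomogeneous_one _ _, by funext a; simp⟩

theorem multiHomogeneous_prod_mem {n : ℕ} {ι : Type*} (S : Finset ι) (d : ι → Fin n → ℕ)
    (Φ : ι → (Fin n → Fin 2 → ℂ) → ℂ) (h : ∀ i ∈ S, Φ i ∈ multiHomogeneous (d i)) :
    ∏ i ∈ S, Φ i ∈ multiHomogeneous (∑ i ∈ S, d i) := by
  classical
  induction S using Finset.induction_on with
  | empty => simpa using one_mem_multiHomogeneous
  | insert i S hi ih =>
    rw [Finset.prod_insert hi, Finset.sum_insert hi]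
    exact multiHomogeneous_mul_mem (h i (Finset.mem_insert_self _ _))
      (ih fun j hj => h j (Finset.mem_insert_of_mem hj))

theorem coord_mem_multiHomogeneous {n : ℕ} (i : Fin n) (k : Fin 2) :
    (fun a : Fin n → Fin 2 → ℂ => a i k) ∈ multiHomogeneous (Pi.single i 1) := by
  refine Submodule.subset_span
    ⟨Function.update 1 i (MvPolynomial.X k), fun j => ?_, ?_⟩
  · by_cases h : j = i
    · subst h; simpa using MvPolynomial.isHomogeneous_X _ _
    · simpa [h] using MvPolynomial.isHomogeneous_one _ _
  · funext a
    rw [Finset.prod_eq_single i (fun j _ hj => by simp [hj]) (by simp)]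
    simp

theorem bracket_mem_multiHomogeneous {n : ℕ} (i j : Fin n) :
    (fun a : Fin n → Fin 2 → ℂ => bracket (a i) (a j)) ∈
      multiHomogeneous (Pi.single i 1 + Pi.single j 1) :=
  Submodule.sub_mem _
    (multiHomogeneous_mul_mem (coord_mem_multiHomogeneous i 0) (coord_mem_multiHomogeneous j 1))
    (multiHomogeneous_mul_mem (coord_mem_multiHomogeneous i 1) (coord_mem_multiHomogeneous j 0))

/-! ### Polarisation and symmetric functions of the zeros. -/

/-- The signed sum over the subsets that contain the range of `φ` detects surjectivity. -/
theorem sum_neg_one_pow_card_compl_of_range_subset {n : ℕ} (φ : Fin n → Fin n) :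
    ∑ S : Finset (Fin n), (-1 : ℂ) ^ (Sᶜ).card * (if ∀ i, φ i ∈ S then 1 else 0) =
      if Function.Surjective φ then 1 else 0 := by
  classical
  -- The sum is the expansion of `∏ⱼ (1 + εⱼ)` with `εⱼ = 0` on the range of `φ` and `εⱼ = -1` off
  -- it.
  have h := Finset.prod_add (fun _ : Fin n => (1 : ℂ))
    (fun j => if j ∈ Set.range φ then 0 else -1) Finset.univ
  rw [Finset.powerset_univ] at h
  have h1 : ∀ S : Finset (Fin n), (-1 : ℂ) ^ (Sᶜ).card * (if ∀ i, φ i ∈ S then 1 else 0) =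
      (∏ i ∈ S, (1 : ℂ)) * ∏ j ∈ Finset.univ \ S, (if j ∈ Set.range φ then (0 : ℂ) else -1) := by
    intro S
    rw [Finset.prod_const_one, one_mul, ← Finset.compl_eq_univ_sdiff]
    split_ifs with hS
    · rw [mul_one, ← Finset.prod_const]
      refine Finset.prod_congr rfl fun j hj => ?_
      rw [if_neg]
      rintro ⟨i, rfl⟩
      exact Finset.mem_compl.mp hj (hS i)
    · push Not at hS
      obtain ⟨i, hi⟩ := hS
      rw [mul_zero, eq_comm]
      exact Finset.prod_eq_zero (Finset.mem_compl.mpr hi) (by simp)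
  rw [Finset.sum_congr rfl fun S _ => h1 S, ← h]
  split_ifs with hφ
  · exact Finset.prod_eq_one fun j _ => by simpa using hφ j
  · simp only [Function.Surjective, not_forall] at hφ
    obtain ⟨j, hj⟩ := hφ
    refine Finset.prod_eq_zero (Finset.mem_univ j) ?_
    rw [if_neg (by simpa using hj)]
    ring

/-- Polarisation: a permanent is a signed sum of products of sums. -/
theorem sum_perm_prod_eq {n : ℕ} (M : Fin n → Fin n → ℂ) :
    ∑ σ : Equiv.Perm (Fin n), ∏ i, M (σ i) i =
      ∑ S : Finset (Fin n), (-1 : ℂ) ^ (Sᶜ).card * ∏ i, ∑ j ∈ S, M j i := by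
  classical
  have h1 : ∀ S : Finset (Fin n), (-1 : ℂ) ^ (Sᶜ).card * ∏ i, ∑ j ∈ S, M j i =
      ∑ φ : Fin n → Fin n, (∏ i, M (φ i) i) *
        ((-1 : ℂ) ^ (Sᶜ).card * (if ∀ i, φ i ∈ S then 1 else 0)) := by
    intro S
    have h2 : ∀ i, ∑ j ∈ S, M j i = ∑ j, M j i * (if j ∈ S then 1 else 0) := by
      intro i
      simp
    simp_rw [h2]
    rw [Fintype.prod_sum, Finset.mul_sum]
    refine Finset.sum_congr rfl fun φ _ => ?_
    rw [Finset.prod_mul_distrib, Finset.prod_ite_zero]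
    simp only [Finset.mem_univ, true_imp_iff, Finset.prod_const_one]
    ring
  rw [Finset.sum_congr rfl fun S _ => h1 S, Finset.sum_comm]
  simp_rw [← Finset.mul_sum, sum_neg_one_pow_card_compl_of_range_subset, mul_ite, mul_one,
    mul_zero]
  rw [← Finset.sum_filter]
  refine Finset.sum_bij (fun σ _ => (σ : Fin n → Fin n)) (fun σ _ => by simpa using σ.surjective)
    (fun σ _ τ _ h => DFunLike.coe_injective h) (fun φ hφ => ?_) fun σ _ => rfl
  have hφ' := (Finset.mem_filter.mp hφ).2
  exact ⟨Equiv.ofBijective φ (Finite.injective_iff_bijective.mp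
    (Finite.injective_iff_surjective.mpr hφ')), Finset.mem_univ _, rfl⟩

/-- `∏ᵢ q(aᵢ)` is a polynomial in the coefficients of `∏ᵢ [·, aᵢ]`. -/
theorem exists_globalSection_prod_eval {n D : ℕ} {q : MvPolynomial (Fin 2) ℂ}
    (hq : q.IsHomogeneous D) :
    ∃ F ∈ globalSections (BinaryForm n) D, ∀ a : Fin n → Fin 2 → ℂ,
      F (formOfPoints a) = ∏ i, MvPolynomial.eval (a i) q := by
  obtain ⟨c, b, -, rfl⟩ := exists_eq_C_mul_prod_linForm hq
  have hF := globalSections_prod_mem Finset.univ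
    (fun (j : Fin D) (f : BinaryForm n) => MvPolynomial.eval (b j) f.1) (fun _ => 1)
    fun j _ => eval_mem_globalSections (b j)
  rw [Finset.sum_const, Finset.card_univ, Fintype.card_fin, smul_eq_mul, mul_one] at hF
  -- With `q = c ∏ⱼ [·, bⱼ]` and `f = ∏ᵢ [·, aᵢ]`, exchanging the products turns `∏ᵢ q(aᵢ)` into `c
  -- ^ n ∏ⱼ (-1) ^ n f(bⱼ)`, and each `f(bⱼ)` is linear in `f`.
  refine ⟨_, Submodule.smul_mem _ (c ^ n * ((-1) ^ n) ^ D) hF, fun a => ?_⟩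
  simp only [Pi.smul_apply, smul_eq_mul, eval_formOfPoints, map_mul, MvPolynomial.eval_C, map_prod,
    eval_linForm, Finset.prod_mul_distrib, Finset.prod_const, Finset.card_univ, Fintype.card_fin]
  rw [Finset.prod_comm, mul_assoc]
  congr 1
  simp_rw [fun i j => bracket_swap (b j) (a i), Finset.prod_neg]
  simp [Finset.prod_mul_distrib, ← mul_assoc, ← pow_mul, mul_comm D n, ← mul_pow]

/-- The symmetrisation of a function homogeneous of degree `D` in each of `n` points is a homogeneous
polynomial of degree `D` in the coefficients of the binary form with these zeros. -/
theorem exists_globalSection_symmetrization {n D : ℕ} {Φ : (Fin n → Fin 2 → ℂ) → ℂ}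
    (hΦ : Φ ∈ multiHomogeneous fun _ => D) :
    ∃ F ∈ globalSections (BinaryForm n) D, ∀ a : Fin n → Fin 2 → ℂ,
      F (formOfPoints a) = ∑ σ : Equiv.Perm (Fin n), Φ fun i => a (σ i) := by
  induction hΦ using Submodule.span_induction with
  | zero => exact ⟨0, Submodule.zero_mem _, fun a => by simp⟩
  | add Φ Ψ _ _ h h' =>
    obtain ⟨F, hF, hF'⟩ := h
    obtain ⟨G, hG, hG'⟩ := h'
    exact ⟨F + G, Submodule.add_mem _ hF hG, fun a => by
      simp [hF', hG', Finset.sum_add_distrib]⟩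
  | smul c Φ _ h =>
    obtain ⟨F, hF, hF'⟩ := h
    exact ⟨c • F, Submodule.smul_mem _ _ hF, fun a => by simp [hF', Finset.mul_sum]⟩
  | mem Φ h =>
    obtain ⟨w, hw, rfl⟩ := h
    -- Polarisation reduces the permanent of the matrix `wⱼ(aᵢ)` to products `∏ᵢ q(aᵢ)` with a
    -- single form `q = ∑_{j ∈ S} wⱼ`.
    choose F hF hF' using fun S : Finset (Fin n) =>
      exists_globalSection_prod_eval (n := n)
        (MvPolynomial.IsHomogeneous.sum S w D fun i _ => hw i)
    refine ⟨∑ S, (-1 : ℂ) ^ (Sᶜ).card • F S,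
      Submodule.sum_mem _ fun S _ => Submodule.smul_mem _ _ (hF S), fun a => ?_⟩
    simp only [Finset.sum_apply, Pi.smul_apply, smul_eq_mul, hF', map_sum]
    rw [← sum_perm_prod_eq fun j i => MvPolynomial.eval (a i) (w j),
      ← Equiv.sum_comp (Equiv.inv (Equiv.Perm (Fin n)))]
    refine Finset.sum_congr rfl fun σ _ => ?_
    rw [← Equiv.prod_comp σ]
    simp

/-- A symmetric `SL₂`-invariant function of `n` points, homogeneous of the same degree in each of
them, is an invariant of the binary form with these zeros. -/
theorem exists_invariantSection_of_symmetric {n D : ℕ} (hn : 0 < n)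
    {Φ : (Fin n → Fin 2 → ℂ) → ℂ} (hΦ : Φ ∈ multiHomogeneous fun _ => D)
    (hsymm : ∀ (a : Fin n → Fin 2 → ℂ) (σ : Equiv.Perm (Fin n)), Φ (fun i => a (σ i)) = Φ a)
    (hinv : ∀ (a : Fin n → Fin 2 → ℂ) (g : SL(2, ℂ)), Φ (fun i => g.1.mulVec (a i)) = Φ a) :
    ∃ F ∈ invariantSections SL(2, ℂ) (BinaryForm n) D, ∀ a, F (formOfPoints a) = Φ a := by
  obtain ⟨F, hF, hF'⟩ := exists_globalSection_symmetrization hΦ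
  have key : ∀ a, F (formOfPoints a) = (n.factorial : ℂ) * Φ a := fun a => by
    rw [hF', Finset.sum_congr rfl fun σ _ => hsymm a σ]
    simp [Fintype.card_perm]
  have hne : (n.factorial : ℂ) ≠ 0 := by exact_mod_cast n.factorial_ne_zero
  refine ⟨(n.factorial : ℂ)⁻¹ • F, ⟨Submodule.smul_mem _ _ hF, fun g f => ?_⟩, fun a => ?_⟩
  · obtain ⟨a, rfl⟩ := exists_eq_formOfPoints hn f
    simp only [Pi.smul_apply, smul_formOfPoints, key, hinv]
  · simp [key, hne]

/-! ### Bracket monomials attached to permutations -/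

/-- The bracket monomial `∏ᵢ [aᵢ, a_{π i}]`, of degree two in each `aᵢ`. -/
def permBracket {n : ℕ} (a : Fin n → Fin 2 → ℂ) (π : Equiv.Perm (Fin n)) : ℂ :=
  ∏ i, bracket (a i) (a (π i))

theorem permBracket_mem_multiHomogeneous {n : ℕ} (π : Equiv.Perm (Fin n)) :
    (fun a : Fin n → Fin 2 → ℂ => permBracket a π) ∈ multiHomogeneous fun _ : Fin n => 2 := by
  have h := multiHomogeneous_prod_mem Finset.univ _ _
    fun (i : Fin n) _ => bracket_mem_multiHomogeneous i (π i)
  have h1 : (∏ i, fun a : Fin n → Fin 2 → ℂ => bracket (a i) (a (π i))) =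
      fun a : Fin n → Fin 2 → ℂ => permBracket a π := by
    funext a
    rw [Finset.prod_apply]; rfl
  have h2 : (∑ i, (Pi.single i 1 + Pi.single (π i) 1) : Fin n → ℕ) = fun _ => 2 := by
    rw [Finset.sum_add_distrib, Equiv.sum_comp π fun i => (Pi.single i 1 : Fin n → ℕ)]
    funext j
    simp [Finset.sum_apply, Pi.single_apply]
  rwa [h1, h2] at h

/-- Relabelling the points permutes the bracket monomials by conjugation, so their span is stable
under the symmetric group. -/
theorem permBracket_comp {n : ℕ} (a : Fin n → Fin 2 → ℂ) (σ π : Equiv.Perm (Fin n)) :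
    permBracket (fun i => a (σ i)) π = permBracket a (σ * π * σ⁻¹) := by
  rw [permBracket, permBracket,
    ← Equiv.prod_comp σ fun i => bracket (a i) (a ((σ * π * σ⁻¹) i))]
  simp

theorem permBracket_mulVec {n : ℕ} (g : SL(2, ℂ)) (a : Fin n → Fin 2 → ℂ)
    (π : Equiv.Perm (Fin n)) : permBracket (fun i => g.1.mulVec (a i)) π = permBracket a π := by
  simp only [permBracket, bracket_mulVec, g.2, one_mul]

/-- The norm under the symmetric group of a linear combination of the bracket monomials is an
invariant. -/
theorem exists_invariantSection_prod_dual {n : ℕ} (hn : 0 < n)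
    (ℓ : Module.Dual ℂ (Equiv.Perm (Fin n) → ℂ)) :
    ∃ F ∈ invariantSections SL(2, ℂ) (BinaryForm n) (n.factorial * 2),
      ∀ a : Fin n → Fin 2 → ℂ, F (formOfPoints a) =
        ∏ σ : Equiv.Perm (Fin n), ℓ (permBracket fun i => a (σ i)) := by
  refine exists_invariantSection_of_symmetric hn ?_ (fun a τ => ?_) fun a g => ?_
  · have h1 : ∀ σ : Equiv.Perm (Fin n),
        (fun a : Fin n → Fin 2 → ℂ => ℓ (permBracket fun i => a (σ i))) ∈
          multiHomogeneous fun _ => 2 := by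
      intro σ
      have : (fun a : Fin n → Fin 2 → ℂ => ℓ (permBracket fun i => a (σ i))) =
          ∑ π, ℓ (fun j => if π = j then 1 else 0) •
            fun a : Fin n → Fin 2 → ℂ => permBracket a (σ * π * σ⁻¹) := by
        funext a
        rw [LinearMap.pi_apply_eq_sum_univ ℓ, Finset.sum_apply]
        exact Finset.sum_congr rfl fun π _ => by
          rw [permBracket_comp, smul_eq_mul, mul_comm]; rfl
      rw [this]
      exact Submodule.sum_mem _ fun π _ =>
        Submodule.smul_mem _ _ (permBracket_mem_multiHomogeneous _)
    have h2 := multiHomogeneous_prod_mem Finset.univ _ _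
      fun (σ : Equiv.Perm (Fin n)) _ => h1 σ
    have h3 : (∑ _σ : Equiv.Perm (Fin n), (fun _ : Fin n => 2)) =
        fun _ => n.factorial * 2 := by
      funext j
      simp [Fintype.card_perm]
    have h4 : (∏ σ : Equiv.Perm (Fin n),
        fun a : Fin n → Fin 2 → ℂ => ℓ (permBracket fun i => a (σ i))) =
        fun a => ∏ σ : Equiv.Perm (Fin n), ℓ (permBracket fun i => a (σ i)) := by
      funext a
      rw [Finset.prod_apply]
    rwa [h3, h4] at h2
  · exact Equiv.prod_comp (Equiv.mulLeft τ)
      fun σ : Equiv.Perm (Fin n) => ℓ (permBracket fun i => a (σ i))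
  · refine Finset.prod_congr rfl fun σ _ => congrArg ℓ (funext fun π => ?_)
    exact permBracket_mulVec g (fun i => a (σ i)) π

/-! ### Permutations that avoid proportional vectors -/

open scoped Classical in
/-- The indices of the vectors proportional to a given one. -/
def parallelClass {n : ℕ} (a : Fin n → Fin 2 → ℂ) (v : Fin 2 → ℂ) : Finset (Fin n) :=
  Finset.univ.filter fun j => bracket v (a j) = 0

theorem mem_parallelClass {n : ℕ} {a : Fin n → Fin 2 → ℂ} {v : Fin 2 → ℂ} {j : Fin n} :
    j ∈ parallelClass a v ↔ bracket v (a j) = 0 := by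
  simp [parallelClass]

theorem parallelClass_comp {n : ℕ} (a : Fin n → Fin 2 → ℂ) (σ : Equiv.Perm (Fin n))
    (v : Fin 2 → ℂ) :
    (parallelClass (fun i => a (σ i)) v).card = (parallelClass a v).card := by
  refine Finset.card_bij (fun j _ => σ j) (fun j hj => ?_) (fun i _ j _ h => σ.injective h)
    fun j hj => ⟨σ.symm j, ?_, by simp⟩
  · exact mem_parallelClass.mpr ((mem_parallelClass (a := fun i => a (σ i))).mp hj)
  · rw [mem_parallelClass] at hj ⊢
    simpa using hj

/-- Hall's marriage theorem for the relation of not being proportional, with some values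
prescribed. -/
theorem exists_perm_bracket_ne_zero {n : ℕ} {a : Fin n → Fin 2 → ℂ} (ha : ∀ i, a i ≠ 0)
    (R : Finset (Fin n)) (ρ : Fin n → Fin n) (hρ : Set.InjOn ρ R)
    (hcard : ∀ i ∉ R, (parallelClass a (a i) \ R).card ≤
      ((parallelClass a (a i))ᶜ \ R.image ρ).card) :
    ∃ π : Equiv.Perm (Fin n), (∀ i ∈ R, π i = ρ i) ∧
      ∀ i ∉ R, bracket (a i) (a (π i)) ≠ 0 := by
  classical
  have hall := (Finset.all_card_le_biUnion_card_iff_exists_injective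
    fun i : {i // i ∉ R} => (parallelClass a (a i))ᶜ \ R.image ρ).mp (by
    intro S
    rcases S.eq_empty_or_nonempty with rfl | ⟨i, hi⟩
    · simp
    -- If `S` lies in one class, Hall's condition is the hypothesis. Otherwise `S` has two
    -- nonproportional members, no vector is proportional to both, and every value outside the image
    -- of `ρ` is allowed for one of them.
    by_cases hS : ∀ j ∈ S, bracket (a i) (a j) = 0
    · calc S.card = (S.map (Function.Embedding.subtype _)).card := (Finset.card_map _).symm
        _ ≤ (parallelClass a (a i) \ R).card := Finset.card_le_card fun j hj => by
            obtain ⟨k, hk, rfl⟩ := Finset.mem_map.mp hj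
            exact Finset.mem_sdiff.mpr ⟨mem_parallelClass.mpr (hS k hk), k.2⟩
        _ ≤ ((parallelClass a (a i))ᶜ \ R.image ρ).card := hcard i i.2
        _ ≤ _ := Finset.card_le_card (Finset.subset_biUnion_of_mem
            (fun i : {i // i ∉ R} => (parallelClass a (a i))ᶜ \ R.image ρ) hi)
    · push Not at hS
      obtain ⟨j, hj, hij⟩ := hS
      calc S.card = (S.map (Function.Embedding.subtype _)).card := (Finset.card_map _).symm
        _ ≤ Rᶜ.card := Finset.card_le_card fun j hj => by
            obtain ⟨k, hk, rfl⟩ := Finset.mem_map.mp hj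
            exact Finset.mem_compl.mpr k.2
        _ = (R.image ρ)ᶜ.card := by
            rw [Finset.card_compl, Finset.card_compl, Finset.card_image_of_injOn hρ]
        _ ≤ _ := Finset.card_le_card fun k hk => by
            rw [Finset.mem_biUnion]
            by_cases hik : bracket (a i) (a k) = 0
            · refine ⟨j, hj, Finset.mem_sdiff.mpr ⟨Finset.mem_compl.mpr fun h => hij ?_,
                Finset.mem_compl.mp hk⟩⟩
              have hkj := mem_parallelClass.mp h
              rw [bracket_swap, neg_eq_zero] at hkj
              exact bracket_trans (ha k) hik hkj
            · exact ⟨i, hi, Finset.mem_sdiff.mpr ⟨Finset.mem_compl.mpr fun h =>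
                hik (mem_parallelClass.mp h), Finset.mem_compl.mp hk⟩⟩)
  obtain ⟨f, hf, hf'⟩ := hall
  have hinj : Function.Injective fun i => if h : i ∈ R then ρ i else f ⟨i, h⟩ := by
    have aux : ∀ i ∈ R, ∀ j (hj : j ∉ R), ρ i ≠ f ⟨j, hj⟩ := fun i hi j hj h =>
      (Finset.mem_sdiff.mp (hf' ⟨j, hj⟩)).2 (h ▸ Finset.mem_image_of_mem ρ hi)
    intro i j hij
    by_cases hi : i ∈ R <;> by_cases hj : j ∈ R
    · simp only [dif_pos hi, dif_pos hj] at hij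
      exact hρ hi hj hij
    · simp only [dif_pos hi, dif_neg hj] at hij
      exact (aux i hi j hj hij).elim
    · simp only [dif_neg hi, dif_pos hj] at hij
      exact (aux j hj i hi hij.symm).elim
    · simp only [dif_neg hi, dif_neg hj] at hij
      exact congrArg Subtype.val (hf hij)
  refine ⟨Equiv.ofBijective _ (Finite.injective_iff_bijective.mp hinj), fun i hi => ?_,
    fun i hi h => ?_⟩
  · simp [hi]
  · rw [Equiv.ofBijective_apply, dif_neg hi] at h
    exact Finset.mem_compl.mp (Finset.mem_sdiff.mp (hf' ⟨i, hi⟩)).1 (mem_parallelClass.mpr h)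

theorem exists_permBracket_ne_zero {n : ℕ} {a : Fin n → Fin 2 → ℂ} (ha : ∀ i, a i ≠ 0)
    (h : ∀ i, 2 * (parallelClass a (a i)).card ≤ n) : ∃ π, permBracket a π ≠ 0 := by
  obtain ⟨π, -, hπ⟩ := exists_perm_bracket_ne_zero ha ∅ id (by simp) fun i _ => by
    have := h i
    rw [Finset.image_empty, Finset.sdiff_empty, Finset.sdiff_empty, Finset.card_compl,
      Fintype.card_fin]
    omega
  exact ⟨π, Finset.prod_ne_zero_iff.mpr fun i _ => hπ i (Finset.notMem_empty i)⟩

/-- The strict inequality leaves each class at least one spare value in its complement, so losing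
the value `j₀` does no harm. -/
theorem exists_perm_apply_eq {n : ℕ} {a : Fin n → Fin 2 → ℂ} (ha : ∀ i, a i ≠ 0)
    (h : ∀ i, 2 * (parallelClass a (a i)).card < n) (i₀ j₀ : Fin n) :
    ∃ π : Equiv.Perm (Fin n), π i₀ = j₀ ∧ ∀ i ≠ i₀, bracket (a i) (a (π i)) ≠ 0 := by
  obtain ⟨π, h1, hπ⟩ := exists_perm_bracket_ne_zero ha {i₀} (fun _ => j₀) (by simp) fun i _ => by
    have h1 := h i
    have h2 := Finset.le_card_sdiff {j₀} (parallelClass a (a i))ᶜ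
    rw [Finset.card_compl, Fintype.card_fin, Finset.card_singleton] at h2
    rw [Finset.image_singleton]
    refine (Finset.card_le_card Finset.sdiff_subset).trans (le_trans ?_ h2)
    omega
  exact ⟨π, h1 i₀ (Finset.mem_singleton_self _), fun i hi => hπ i (by simpa using hi)⟩

/-- Prescribing two values may remove two elements from the complement of a class `C`, while the
slack is only one. If `C` contains `k` or `i₃`, at most one is lost; if it contains `i₁` or `i₂`,
there is one index fewer to place. Otherwise the class of `i₁`, at least as large as `C`, lies in
what remains of the complement. -/
theorem exists_perm_apply_eq_apply_eq {n : ℕ} {a : Fin n → Fin 2 → ℂ} (ha : ∀ i, a i ≠ 0)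
    (h : ∀ i, 2 * (parallelClass a (a i)).card < n) {i₁ i₂ i₃ k : Fin n}
    (hmax : ∀ i, (parallelClass a (a i)).card ≤ (parallelClass a (a i₁)).card)
    (h12 : bracket (a i₁) (a i₂) ≠ 0) (h13 : bracket (a i₁) (a i₃) ≠ 0)
    (h1k : bracket (a i₁) (a k) ≠ 0) (h3k : bracket (a i₃) (a k) ≠ 0) :
    ∃ π : Equiv.Perm (Fin n), π i₁ = k ∧ π i₂ = i₃ ∧
      ∀ i, i ≠ i₁ → i ≠ i₂ → bracket (a i) (a (π i)) ≠ 0 := by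
  have hne : i₂ ≠ i₁ := by rintro rfl; exact h12 (bracket_self _)
  have hne' : i₃ ≠ k := by rintro rfl; exact h3k (bracket_self _)
  obtain ⟨π, h1, hπ⟩ := exists_perm_bracket_ne_zero ha {i₁, i₂}
    (fun i => if i = i₁ then k else i₃) (by
      intro i hi j hj hij
      simp only [Finset.coe_insert, Finset.coe_singleton, Set.mem_insert_iff,
        Set.mem_singleton_iff] at hi hj
      rcases hi with rfl | rfl <;> rcases hj with rfl | rfl <;> simp_all) (by
      intro i hi
      have himg : ({i₁, i₂} : Finset (Fin n)).image (fun i => if i = i₁ then k else i₃)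
          = {k, i₃} := by
        simp [Finset.image_insert, hne]
      rw [himg]
      set C := parallelClass a (a i) with hC
      have hn := h i
      rw [← hC] at hn
      have hcompl : Cᶜ.card = n - C.card := by rw [Finset.card_compl, Fintype.card_fin]
      by_cases hk : k ∈ C ∨ i₃ ∈ C
      · have : ∃ x, Cᶜ \ {x} ⊆ Cᶜ \ {k, i₃} := by
          rcases hk with hk | hk
          · refine ⟨i₃, fun j hj => ?_⟩
            simp only [Finset.mem_sdiff, Finset.mem_compl, Finset.mem_singleton,
              Finset.mem_insert] at hj ⊢
            exact ⟨hj.1, fun h => h.elim (fun h => hj.1 (h ▸ hk)) hj.2⟩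
          · refine ⟨k, fun j hj => ?_⟩
            simp only [Finset.mem_sdiff, Finset.mem_compl, Finset.mem_singleton,
              Finset.mem_insert] at hj ⊢
            exact ⟨hj.1, fun h => h.elim hj.2 (fun h => hj.1 (h ▸ hk))⟩
        obtain ⟨x, hx⟩ := this
        have h2 := (Finset.le_card_sdiff {x} Cᶜ).trans (Finset.card_le_card hx)
        rw [Finset.card_singleton, hcompl] at h2
        refine (Finset.card_le_card Finset.sdiff_subset).trans (le_trans ?_ h2)
        omega
      by_cases h12C : i₁ ∈ C ∨ i₂ ∈ C
      · have : ∃ x ∈ C, C \ {i₁, i₂} ⊆ C.erase x := by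
          rcases h12C with hx | hx
          · exact ⟨i₁, hx, fun j hj => by
              simp only [Finset.mem_sdiff, Finset.mem_insert, Finset.mem_singleton,
                Finset.mem_erase, not_or] at hj ⊢
              exact ⟨hj.2.1, hj.1⟩⟩
          · exact ⟨i₂, hx, fun j hj => by
              simp only [Finset.mem_sdiff, Finset.mem_insert, Finset.mem_singleton,
                Finset.mem_erase, not_or] at hj ⊢
              exact ⟨hj.2.2, hj.1⟩⟩
        obtain ⟨x, hx, hsub⟩ := this
        have h1 := Finset.card_le_card hsub
        have h2 := Finset.le_card_sdiff {k, i₃} Cᶜ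
        have h3 := Finset.card_le_two (a := k) (b := i₃)
        rw [hcompl] at h2
        rw [Finset.card_erase_of_mem hx] at h1
        omega
      · push Not at hk h12C
        refine (Finset.card_le_card Finset.sdiff_subset).trans ((hmax i).trans ?_)
        refine Finset.card_le_card fun j hj => ?_
        have hj' := mem_parallelClass.mp hj
        simp only [Finset.mem_sdiff, Finset.mem_compl, Finset.mem_insert, Finset.mem_singleton,
          not_or]
        refine ⟨fun hjC => h12C.1 ?_, ?_, ?_⟩
        · rw [hC, mem_parallelClass] at hjC ⊢
          rw [bracket_swap, neg_eq_zero] at hj'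
          exact bracket_trans (ha j) hjC hj'
        · rintro rfl; exact h1k hj'
        · rintro rfl; exact h13 hj')
  refine ⟨π, ?_, ?_, fun i hi₁ hi₂ => hπ i (by simp [hi₁, hi₂])⟩
  · simpa using h1 i₁ (by simp)
  · simpa [hne] using h1 i₂ (by simp)

/-! ### Reconstruction of a stable tuple from its bracket monomials -/

section Reconstruction

variable {n : ℕ} {a b : Fin n → Fin 2 → ℂ} {c : ℂ}

/-- A permutation with `π i = j` and all other factors nonzero makes the vanishing of a monomial
equivalent to that of the single bracket `[aᵢ, aⱼ]`. -/
theorem bracket_eq_zero_iff_of_permBracket (ha : ∀ i, a i ≠ 0)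
    (hst : ∀ i, 2 * (parallelClass a (a i)).card < n) (hc : c ≠ 0)
    (h : ∀ π, permBracket b π = c * permBracket a π) (i j : Fin n) :
    bracket (b i) (b j) = 0 ↔ bracket (a i) (a j) = 0 := by
  have key : ∀ i j, bracket (a i) (a j) ≠ 0 → bracket (b i) (b j) ≠ 0 := by
    intro i j hij
    obtain ⟨π, hπ, hπ'⟩ := exists_perm_apply_eq ha hst i j
    have h1 : permBracket a π ≠ 0 := Finset.prod_ne_zero_iff.mpr fun k _ => by
      by_cases hk : k = i
      · rwa [hk, hπ]
      · exact hπ' k hk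
    have h2 : permBracket b π ≠ 0 := by rw [h]; exact mul_ne_zero hc h1
    have := Finset.prod_ne_zero_iff.mp h2 i (Finset.mem_univ i)
    rwa [hπ] at this
  refine ⟨fun hb => by_contra fun h' => key i j h' hb, fun hij => by_contra fun hb => ?_⟩
  obtain ⟨π, hπ, hπ'⟩ := exists_perm_apply_eq ha hst i j
  have h1 : permBracket b π ≠ 0 := Finset.prod_ne_zero_iff.mpr fun k _ => by
    by_cases hk : k = i
    · rwa [hk, hπ]
    · exact key _ _ (hπ' k hk)
  refine h1 ?_
  rw [h, mul_eq_zero]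
  exact Or.inr (Finset.prod_eq_zero (Finset.mem_univ i) (by rw [hπ, hij]))

/-- Composing `π` with the swap of `i₁` and `i₂` changes only two factors of the monomial. The
quotient of the two monomials is the cross-ratio of the points `i₁, i₂, i₃, k`, and it does not see
the scalar `c`. -/
theorem bracket_crossRatio_eq (ha : ∀ i, a i ≠ 0) (hb : ∀ i, b i ≠ 0)
    (hst : ∀ i, 2 * (parallelClass a (a i)).card < n) (hc : c ≠ 0)
    (h : ∀ π, permBracket b π = c * permBracket a π) {i₁ i₂ i₃ : Fin n}
    (hmax : ∀ i, (parallelClass a (a i)).card ≤ (parallelClass a (a i₁)).card)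
    (h12 : bracket (a i₁) (a i₂) ≠ 0) (h13 : bracket (a i₁) (a i₃) ≠ 0) (k : Fin n) :
    bracket (b i₁) (b k) * bracket (b i₂) (b i₃) * (bracket (a i₁) (a i₃) * bracket (a i₂) (a k)) =
    bracket (a i₁) (a k) * bracket (a i₂) (a i₃) *
      (bracket (b i₁) (b i₃) * bracket (b i₂) (b k)) := by
  have hiff := bracket_eq_zero_iff_of_permBracket ha hst hc h
  by_cases h1k : bracket (a i₁) (a k) = 0
  · rw [h1k, (hiff _ _).mpr h1k]; ring
  by_cases h3k : bracket (a i₃) (a k) = 0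
  · obtain ⟨r, hr⟩ := exists_eq_smul_of_bracket_eq_zero (ha i₃) h3k
    obtain ⟨s, hs⟩ := exists_eq_smul_of_bracket_eq_zero (hb i₃) ((hiff _ _).mpr h3k)
    rw [hr, hs]
    simp only [bracket_smul_right]
    ring
  obtain ⟨π, hπ1, hπ2, hπ⟩ := exists_perm_apply_eq_apply_eq ha hst hmax h12 h13 h1k h3k
  have hne : i₁ ≠ i₂ := by rintro rfl; exact h12 (bracket_self _)
  have hmem : i₂ ∈ Finset.univ.erase i₁ := by simp [hne.symm]
  have expand : ∀ (v : Fin n → Fin 2 → ℂ) (τ : Equiv.Perm (Fin n)),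
      permBracket v τ = bracket (v i₁) (v (τ i₁)) * (bracket (v i₂) (v (τ i₂)) *
        ∏ i ∈ (Finset.univ.erase i₁).erase i₂, bracket (v i) (v (τ i))) := fun v τ => by
    rw [permBracket, ← Finset.mul_prod_erase _ _ (Finset.mem_univ i₁),
      ← Finset.mul_prod_erase _ _ hmem]
  have hrest : ∀ v : Fin n → Fin 2 → ℂ,
      ∏ i ∈ (Finset.univ.erase i₁).erase i₂, bracket (v i) (v ((π * Equiv.swap i₁ i₂) i)) =
      ∏ i ∈ (Finset.univ.erase i₁).erase i₂, bracket (v i) (v (π i)) := fun v =>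
    Finset.prod_congr rfl fun i hi => by
      rw [Finset.mem_erase, Finset.mem_erase] at hi
      rw [Equiv.Perm.mul_apply, Equiv.swap_apply_of_ne_of_ne hi.2.1 hi.1]
  have e1 := h π
  have e2 := h (π * Equiv.swap i₁ i₂)
  rw [expand, expand, hπ1, hπ2] at e1
  rw [expand, expand, hrest, hrest] at e2
  simp only [Equiv.Perm.mul_apply, Equiv.swap_apply_left, Equiv.swap_apply_right, hπ1, hπ2] at e2
  have ra : ∏ i ∈ (Finset.univ.erase i₁).erase i₂, bracket (a i) (a (π i)) ≠ 0 :=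
    Finset.prod_ne_zero_iff.mpr fun i hi => by
      rw [Finset.mem_erase, Finset.mem_erase] at hi
      exact hπ i hi.2.1 hi.1
  have rb : ∏ i ∈ (Finset.univ.erase i₁).erase i₂, bracket (b i) (b (π i)) ≠ 0 :=
    Finset.prod_ne_zero_iff.mpr fun i hi => by
      rw [Finset.mem_erase, Finset.mem_erase] at hi
      exact fun h0 => hπ i hi.2.1 hi.1 ((hiff _ _).mp h0)
  refine mul_right_cancel₀ (mul_ne_zero hc (mul_ne_zero ra rb)) ?_
  linear_combination (c * (∏ i ∈ (Finset.univ.erase i₁).erase i₂, bracket (a i) (a (π i))) *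
    bracket (a i₁) (a i₃) * bracket (a i₂) (a k)) * e1 -
    (c * (∏ i ∈ (Finset.univ.erase i₁).erase i₂, bracket (a i) (a (π i))) *
      bracket (a i₁) (a k) * bracket (a i₂) (a i₃)) * e2

/-- If all classes of proportional vectors have fewer than `n / 2` members, then there are three
pairwise nonproportional vectors, the first of which is in a largest class. -/
theorem exists_three_of_stable
    (hn : 0 < n) (hst : ∀ i, 2 * (parallelClass a (a i)).card < n) :
    ∃ i₁ i₂ i₃, (∀ i, (parallelClass a (a i)).card ≤ (parallelClass a (a i₁)).card) ∧
      bracket (a i₁) (a i₂) ≠ 0 ∧ bracket (a i₁) (a i₃) ≠ 0 ∧ bracket (a i₂) (a i₃) ≠ 0 := by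
  obtain ⟨i₁, -, hmax⟩ := Finset.exists_max_image Finset.univ
    (fun i => (parallelClass a (a i)).card) ⟨⟨0, hn⟩, Finset.mem_univ _⟩
  have hex : ∀ S : Finset (Fin n), S.card < n → ∃ i, i ∉ S := fun S hS => by
    by_contra! hall
    rw [Finset.eq_univ_iff_forall.mpr hall, Finset.card_univ, Fintype.card_fin] at hS
    exact hS.false
  obtain ⟨i₂, h2⟩ := hex (parallelClass a (a i₁)) (by have := hst i₁; omega)
  obtain ⟨i₃, h3⟩ := hex (parallelClass a (a i₁) ∪ parallelClass a (a i₂)) (by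
    have h1 := hst i₁
    have h2 := hst i₂
    have := Finset.card_union_le (parallelClass a (a i₁)) (parallelClass a (a i₂))
    omega)
  simp only [Finset.mem_union, not_or, mem_parallelClass] at h2 h3
  exact ⟨i₁, i₂, i₃, fun i => hmax i (Finset.mem_univ i), h2, h3.1, h3.2⟩

theorem exists_matrix_of_permBracket (ha : ∀ i, a i ≠ 0) (hb : ∀ i, b i ≠ 0) (hn : 0 < n)
    (hst : ∀ i, 2 * (parallelClass a (a i)).card < n) (hc : c ≠ 0)
    (h : ∀ π, permBracket b π = c * permBracket a π) :
    ∃ A : Matrix (Fin 2) (Fin 2) ℂ, A.det ≠ 0 ∧ ∀ k, bracket (A.mulVec (a k)) (b k) = 0 := by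
  obtain ⟨i₁, i₂, i₃, hmax, h12, h13, h23⟩ := exists_three_of_stable hn hst
  have hiff := bracket_eq_zero_iff_of_permBracket ha hst hc h
  have hb12 := (hiff i₁ i₂).not.mpr h12
  have hb13 := (hiff i₁ i₃).not.mpr h13
  have hb23 := (hiff i₂ i₃).not.mpr h23
  have cross := bracket_crossRatio_eq ha hb hst hc h hmax h12 h13
  -- The matrix is `u ↦ α [u, a_{i₂}] b_{i₁} + β [a_{i₁}, u] b_{i₂}`. It matches the first two lines
  -- for any `α`, `β`; these values make it match the third, and equality of cross-ratios gives the
  -- rest.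
  set α := bracket (b i₂) (b i₃) * bracket (a i₁) (a i₃) with hα
  set β := bracket (b i₁) (b i₃) * bracket (a i₂) (a i₃) with hβ
  have hαβ : α * β * bracket (a i₁) (a i₂) * bracket (b i₁) (b i₂) ≠ 0 := by
    simp only [hα, hβ, mul_ne_zero_iff]; tauto
  refine ⟨Matrix.of fun i => ![α * b i₁ i * a i₂ 1 - β * b i₂ i * a i₁ 1,
    β * b i₂ i * a i₁ 0 - α * b i₁ i * a i₂ 0], ?_, fun k => ?_⟩
  · convert hαβ using 1
    simp only [Matrix.det_fin_two, Matrix.of_apply, Matrix.cons_val_zero, Matrix.cons_val_one,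
      bracket]
    ring
  · have e := cross k
    have : bracket (Matrix.mulVec (Matrix.of fun i => ![α * b i₁ i * a i₂ 1 - β * b i₂ i * a i₁ 1,
        β * b i₂ i * a i₁ 0 - α * b i₁ i * a i₂ 0]) (a k)) (b k) =
        α * bracket (a k) (a i₂) * bracket (b i₁) (b k) +
        β * bracket (a i₁) (a k) * bracket (b i₂) (b k) := by
      simp only [bracket, Matrix.mulVec, dotProduct, Fin.sum_univ_two, Matrix.of_apply,
        Matrix.cons_val_zero, Matrix.cons_val_one]
      ring
    rw [this, bracket_swap (a k), hα, hβ]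
    linear_combination -e

/-- Tuples with proportional bracket monomials, one of them stable, define binary forms in the same
`SL₂`-orbit up to scale. -/
theorem exists_smul_formOfPoints_eq (ha : ∀ i, a i ≠ 0) (hb : ∀ i, b i ≠ 0) (hn : 0 < n)
    (hst : ∀ i, 2 * (parallelClass a (a i)).card < n) (hc : c ≠ 0)
    (h : ∀ π, permBracket b π = c * permBracket a π) :
    ∃ (g : SL(2, ℂ)) (r : ℂ), formOfPoints b = r • g • formOfPoints a := by
  obtain ⟨A, hA, hAb⟩ := exists_matrix_of_permBracket ha hb hn hst hc h
  -- Dividing by a square root of the determinant moves the matrix into `SL₂`.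
  obtain ⟨δ, hδ⟩ := IsAlgClosed.exists_pow_nat_eq A.det (n := 2) (by norm_num)
  have hδ0 : δ ≠ 0 := by rintro rfl; exact hA (by rw [← hδ]; norm_num)
  have hdet : (δ⁻¹ • A).det = 1 := by
    rw [Matrix.det_smul, Fintype.card_fin, ← hδ]
    field_simp
  choose ν hν using fun k => exists_eq_smul_of_bracket_eq_zero
    (fun h0 => ha k (Matrix.eq_zero_of_mulVec_eq_zero hA h0)) (hAb k)
  let g : SL(2, ℂ) := ⟨δ⁻¹ • A, hdet⟩
  refine ⟨g, ∏ k, ν k * δ, ?_⟩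
  rw [smul_formOfPoints, ← formOfPoints_smul]
  congr 1
  funext k
  change b k = (ν k * δ) • (δ⁻¹ • A).mulVec (a k)
  rw [Matrix.smul_mulVec, smul_smul, mul_assoc, mul_inv_cancel₀ hδ0, mul_one]
  exact hν k

end Reconstruction

/-! ### Separation of orbits implies infinitesimal separation -/

/-- An analytic function all of whose derivatives of positive order vanish is locally constant. -/
theorem eventually_eq_of_iteratedDeriv_eq_zero {f : ℂ → ℂ} {z : ℂ} (hf : AnalyticAt ℂ f z)
    (h : ∀ m, 1 ≤ m → iteratedDeriv m f z = 0) : ∀ᶠ w in nhds z, f w = f z := by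
  have key : ∀ w, ∀ m ≠ 0, (FormalMultilinearSeries.ofScalars ℂ
      (fun n => iteratedDeriv n f z / n.factorial) m fun _ => w - z) = 0 := by
    intro w m hm
    rw [FormalMultilinearSeries.ofScalars_apply_eq, h m (Nat.one_le_iff_ne_zero.mpr hm)]
    simp
  filter_upwards [hf.hasFPowerSeriesAt.eventually_hasSum_sub] with w hw
  rw [hw.unique (hasSum_single 0 (key w))]
  simp

section Infinitesimal

variable {G : Type*} [Group G] {V : Type*} [AddCommGroup V] [Module ℂ V]

theorem differentiable_globalSection_line {r : ℕ} {s : V → ℂ} (hs : s ∈ globalSections V r)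
    (x v : V) : Differentiable ℂ fun ε : ℂ => s (x + ε • v) := by
  obtain ⟨P, -, hP⟩ := hs
  simp only [hP, MvPolynomial.eval_eq, map_add, map_smul, smul_eq_mul]
  fun_prop

theorem globalSection_zero {r : ℕ} (hr : 0 < r) {s : V → ℂ} (hs : s ∈ globalSections V r) :
    s 0 = 0 := by
  simpa [hr.ne'] using globalSections_smul_apply hs 0 0

theorem exists_rep_mk_eq_smul (v : V) (hv : v ≠ 0) :
    ∃ c : ℂ, c ≠ 0 ∧ (Projectivization.mk ℂ v hv).rep = c • v := by
  obtain ⟨c, hc⟩ := Projectivization.exists_smul_eq_mk_rep ℂ v hv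
  exact ⟨c, c.ne_zero, hc.symm⟩

variable [DistribMulAction G V] [SMulCommClass G ℂ V]

theorem div_rep_mk {r : ℕ} {s t : V → ℂ} (hs : s ∈ globalSections V r)
    (ht : t ∈ globalSections V r) (v : V) (hv : v ≠ 0) :
    t (Projectivization.mk ℂ v hv).rep / s (Projectivization.mk ℂ v hv).rep = t v / s v := by
  obtain ⟨c, hc, h⟩ := exists_rep_mk_eq_smul v hv
  rw [h, globalSections_smul_apply hs, globalSections_smul_apply ht,
    mul_div_mul_left _ _ (pow_ne_zero r hc)]

/-- If all derivatives of all `t / s` vanish along `v`, these functions are constant on the line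
through `x` in direction `v`, wherever `s ≠ 0`. Separation puts the nearby points of the line in the
orbit, so a polynomial vanishing on the orbit vanishes along the line to all orders, and `v` is
tangent. -/
theorem exists_iteratedDeriv_ne_zero_of_separates {x : ℙ ℂ V} {r : ℕ} (hr : 0 < r) {s : V → ℂ}
    (hs : s ∈ invariantSections G V r) (hsx : s x.rep ≠ 0)
    (hsep : ∀ y : ℙ ℂ V, s y.rep ≠ 0 → y ∉ MulAction.orbit G x →
      ∃ t ∈ invariantSections G V r, t y.rep / s y.rep ≠ t x.rep / s x.rep)
    (v : V) (hv : ¬ IsTangentToOrbit G x v) :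
    ∃ t ∈ invariantSections G V r, ∃ m : ℕ, 1 ≤ m ∧
      iteratedDeriv m (fun ε : ℂ => t (x.rep + ε • v) / s (x.rep + ε • v)) 0 ≠ 0 := by
  by_contra! hcon
  refine hv fun d h hh hvan => ?_
  have hsd := differentiable_globalSection_line hs.1 x.rep v
  have hs0 : ∀ᶠ ε in nhds (0 : ℂ), s (x.rep + ε • v) ≠ 0 :=
    hsd.continuous.continuousAt.eventually_ne (by simpa using hsx)
  have hconst : ∀ t ∈ invariantSections G V r, ∀ ε : ℂ,
      t (x.rep + ε • v) * s x.rep = t x.rep * s (x.rep + ε • v) := by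
    intro t ht
    have htd := differentiable_globalSection_line ht.1 x.rep v
    have hloc : ∀ᶠ ε in nhds (0 : ℂ), t (x.rep + ε • v) / s (x.rep + ε • v) =
        t (x.rep + (0 : ℂ) • v) / s (x.rep + (0 : ℂ) • v) := by
      refine eventually_eq_of_iteratedDeriv_eq_zero ?_ (hcon t ht)
      exact (htd.analyticAt 0).div (hsd.analyticAt 0) (by simpa using hsx)
    have heq : (fun ε : ℂ => t (x.rep + ε • v) * s x.rep) =ᶠ[nhds 0]
        fun ε : ℂ => t x.rep * s (x.rep + ε • v) := by
      filter_upwards [hloc, hs0] with ε h1 h2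
      rw [zero_smul, add_zero, div_eq_div_iff h2 hsx] at h1
      exact h1
    have ha1 : Differentiable ℂ fun ε : ℂ => t (x.rep + ε • v) * s x.rep := htd.mul_const _
    have ha2 : Differentiable ℂ fun ε : ℂ => t x.rep * s (x.rep + ε • v) := hsd.const_mul _
    exact congrFun (AnalyticOnNhd.eq_of_eventuallyEq (fun z _ => ha1.analyticAt z)
      (fun z _ => ha2.analyticAt z) heq)
  have hzero : (fun ε : ℂ => h (x.rep + ε • v)) =ᶠ[nhds 0] fun _ => 0 := by
    filter_upwards [hs0] with ε hε
    have hne : x.rep + ε • v ≠ 0 := fun h0 => hε (by rw [h0, globalSection_zero hr hs.1])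
    obtain ⟨c, hc, hrep⟩ := exists_rep_mk_eq_smul _ hne
    have hmem : Projectivization.mk ℂ _ hne ∈ MulAction.orbit G x := by
      by_contra hmem
      obtain ⟨t, ht, htne⟩ := hsep _ (by
        rw [hrep, globalSections_smul_apply hs.1]
        exact mul_ne_zero (pow_ne_zero r hc) hε) hmem
      rw [div_rep_mk hs.1 ht.1] at htne
      exact htne ((div_eq_div_iff hε hsx).mpr (hconst t ht ε))
    have := hvan _ hmem
    rw [hrep, globalSections_smul_apply hh] at this
    exact (mul_eq_zero.mp this).resolve_left (pow_ne_zero d hc)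
  rw [hzero.deriv_eq, deriv_const]

end Infinitesimal

/-! ### Multiplicities -/

theorem multiplicity_linForm_formOfPoints {n : ℕ} {a : Fin n → Fin 2 → ℂ} (ha : ∀ i, a i ≠ 0)
    {v : Fin 2 → ℂ} (hv : v ≠ 0) :
    multiplicity (linForm v) (formOfPoints a).1 = (parallelClass a v).card := by
  have hex : ∀ i, ∃ c : ℂ, i ∈ parallelClass a v → a i = c • v := fun i => by
    by_cases hi : i ∈ parallelClass a v
    · obtain ⟨c, hc⟩ := exists_eq_smul_of_bracket_eq_zero hv (mem_parallelClass.mp hi)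
      exact ⟨c, fun _ => hc⟩
    · exact ⟨0, fun h => (hi h).elim⟩
  choose c hc using hex
  have hprod : (formOfPoints a).1 = linForm v ^ (parallelClass a v).card *
      (MvPolynomial.C (∏ i ∈ parallelClass a v, c i) *
        ∏ i ∈ (parallelClass a v)ᶜ, linForm (a i)) := by
    change ∏ i, linForm (a i) = _
    rw [← Finset.prod_mul_prod_compl (parallelClass a v),
      Finset.prod_congr rfl fun i hi => by rw [hc i hi, linForm_smul], Finset.prod_mul_distrib,
      Finset.prod_const, map_prod]
    ring
  refine multiplicity_eq_of_dvd_of_not_dvd (by rw [hprod]; exact dvd_mul_right _ _) ?_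
  rw [hprod, pow_succ]
  intro hdvd
  rw [mul_dvd_mul_iff_left (pow_ne_zero _ (linForm_ne_zero hv))] at hdvd
  obtain ⟨w, hw⟩ := hdvd
  -- The cofactor of the power of `linForm v` is nonzero at `v`, so one more factor cannot divide
  -- it.
  have h0 := congrArg (MvPolynomial.eval v) hw
  rw [map_mul, map_mul, MvPolynomial.eval_C, eval_linForm, bracket_self, zero_mul, mul_eq_zero,
    map_prod] at h0
  rcases h0 with h0 | h0
  · obtain ⟨i, hi, h0⟩ := Finset.prod_eq_zero_iff.mp h0
    exact ha i (by rw [hc i hi, h0, zero_smul])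
  · obtain ⟨i, hi, h0⟩ := Finset.prod_eq_zero_iff.mp h0
    rw [eval_linForm] at h0
    exact Finset.mem_compl.mp hi (mem_parallelClass.mpr h0)

theorem multiplicityAt_eq_card {n : ℕ} {Z : LengthSubscheme n} {a : Fin n → Fin 2 → ℂ}
    (hZ : Z.rep = formOfPoints a) (p : ℙ ℂ (Fin 2 → ℂ)) :
    multiplicityAt Z p = (parallelClass a p.rep).card := by
  have ha := formOfPoints_ne_zero_iff.mp (hZ ▸ Z.rep_nonzero)
  rw [← multiplicity_linForm_formOfPoints ha p.rep_nonzero, multiplicityAt, hZ]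
  rfl

theorem parallelClass_card_eq_multiplicityAt {n : ℕ} {Z : LengthSubscheme n}
    {a : Fin n → Fin 2 → ℂ} (hZ : Z.rep = formOfPoints a) {v : Fin 2 → ℂ} (hv : v ≠ 0) :
    (parallelClass a v).card = multiplicityAt Z (Projectivization.mk ℂ v hv) := by
  obtain ⟨c, hc, hrep⟩ := exists_rep_mk_eq_smul v hv
  rw [multiplicityAt_eq_card hZ, hrep]
  congr 1
  ext i
  simp [mem_parallelClass, bracket_smul_left, hc]

/-! ### Small multiplicities imply (semi)stability -/

/-- Forms of degree `0` are constants, so evaluation at the origin is an invariant that is nonzero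
on nonzero forms. -/
theorem isSemistable_zero (Z : LengthSubscheme 0) : IsSemistable SL(2, ℂ) Z := by
  refine ⟨1, one_pos, fun f => MvPolynomial.eval 0 f.1, ⟨eval_mem_globalSections 0, fun g f => ?_⟩,
    fun h => Z.rep_nonzero ?_⟩
  · change MvPolynomial.eval 0 (g • f).1 = MvPolynomial.eval 0 f.1
    rw [eval_smul, Matrix.mulVec_zero]
  · change MvPolynomial.eval 0 Z.rep.1 = 0 at h
    obtain ⟨c, a, -, hf⟩ := exists_eq_C_mul_prod_linForm Z.rep.2
    rw [hf] at h
    have hc : c = 0 := by simpa using h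
    exact Subtype.ext (by rw [hf, hc]; simp)

theorem isSemistable_of_parallelClass {n : ℕ} (hn : 0 < n) {Z : LengthSubscheme n}
    {a : Fin n → Fin 2 → ℂ} (hZ : Z.rep = formOfPoints a)
    (h : ∀ i, 2 * (parallelClass a (a i)).card ≤ n) : IsSemistable SL(2, ℂ) Z := by
  have ha := formOfPoints_ne_zero_iff.mp (hZ ▸ Z.rep_nonzero)
  obtain ⟨ℓ, hℓ⟩ := Module.exists_dual_forall_apply_ne_zero (K := ℂ)
    (fun σ : Equiv.Perm (Fin n) => permBracket fun i => a (σ i)) fun σ h0 => by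
      obtain ⟨π, hπ⟩ := exists_permBracket_ne_zero (fun i => ha (σ i))
        fun i => by rw [parallelClass_comp]; exact h _
      exact hπ (congrFun h0 π)
  obtain ⟨F, hF, hF'⟩ := exists_invariantSection_prod_dual hn ℓ
  refine ⟨n.factorial * 2, Nat.mul_pos n.factorial_pos two_pos, F, hF, ?_⟩
  rw [hZ, hF']
  exact Finset.prod_ne_zero_iff.mpr fun σ _ => hℓ σ

/-- A linear functional that vanishes on `u` but not on finitely many vectors outside the line
of `u`. -/
theorem exists_dual_apply_eq_zero_forall_ne_zero {E ι : Type*} [AddCommGroup E] [Module ℂ E]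
    [Finite ι] (u : E) (v : ι → E) (hv : ∀ i, v i ∉ Submodule.span ℂ {u}) :
    ∃ ℓ : Module.Dual ℂ E, ℓ u = 0 ∧ ∀ i, ℓ (v i) ≠ 0 := by
  obtain ⟨ℓ, hℓ⟩ := Module.exists_dual_forall_apply_ne_zero (K := ℂ)
    (fun i => (Submodule.span ℂ {u}).mkQ (v i)) fun i h0 => hv i <| by
      simpa only [Submodule.mkQ_apply, Submodule.Quotient.mk_eq_zero] using h0
  refine ⟨ℓ.comp (Submodule.span ℂ {u}).mkQ, ?_, hℓ⟩
  have : (Submodule.span ℂ {u}).mkQ u = 0 := by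
    simpa only [Submodule.mkQ_apply, Submodule.Quotient.mk_eq_zero] using
      Submodule.mem_span_singleton_self u
  rw [LinearMap.comp_apply, this, map_zero]

/-- Were some `permBracket (a ∘ σ)` a multiple of `permBracket b`, reconstruction would put `y` in
the orbit of `x`. Hence some `ℓ` vanishes at `permBracket b` and at none of these, and its norm
separates the two points. -/
theorem exists_separating_section {n : ℕ} (hn : 0 < n) {x y : LengthSubscheme n}
    {a : Fin n → Fin 2 → ℂ} (hx : x.rep = formOfPoints a)
    (h : ∀ i, 2 * (parallelClass a (a i)).card < n) (hy : y ∉ MulAction.orbit SL(2, ℂ) x) :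
    ∃ t ∈ invariantSections SL(2, ℂ) (BinaryForm n) (n.factorial * 2),
      t y.rep = 0 ∧ t x.rep ≠ 0 := by
  have ha := formOfPoints_ne_zero_iff.mp (hx ▸ x.rep_nonzero)
  obtain ⟨b, hb'⟩ := exists_eq_formOfPoints hn y.rep
  have hb := formOfPoints_ne_zero_iff.mp (hb' ▸ y.rep_nonzero)
  obtain ⟨ℓ, hℓ, hℓ'⟩ := exists_dual_apply_eq_zero_forall_ne_zero (permBracket b)
    (fun σ : Equiv.Perm (Fin n) => permBracket fun i => a (σ i)) fun σ hmem => by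
      have haσ : ∀ i, a (σ i) ≠ 0 := fun i => ha (σ i)
      have hst : ∀ i, 2 * (parallelClass (fun i => a (σ i)) (a (σ i))).card < n :=
        fun i => by rw [parallelClass_comp]; exact h _
      obtain ⟨c, hc⟩ := Submodule.mem_span_singleton.mp hmem
      obtain ⟨π, hπ⟩ := exists_permBracket_ne_zero haσ fun i => (hst i).le
      have hc0 : c ≠ 0 := by
        rintro rfl
        rw [zero_smul] at hc
        exact hπ (congrFun hc.symm π)
      obtain ⟨g, r, hgr⟩ := exists_smul_formOfPoints_eq haσ hb hn hst (inv_ne_zero hc0)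
        fun π => by rw [← hc]; simp [hc0]
      rw [formOfPoints_comp, ← hx, ← hb'] at hgr
      refine hy ⟨g, ?_⟩
      change g • x = y
      rw [← x.mk_rep, Projectivization.smul_mk, ← y.mk_rep, Projectivization.mk_eq_mk_iff']
      have hr : r ≠ 0 := by
        rintro rfl
        exact y.rep_nonzero (by rw [hgr, zero_smul])
      exact ⟨r⁻¹, by rw [hgr, smul_smul, inv_mul_cancel₀ hr, one_smul]⟩
  obtain ⟨F, hF, hF'⟩ := exists_invariantSection_prod_dual hn ℓ
  refine ⟨F, hF, ?_, ?_⟩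
  · rw [hb', hF']
    exact Finset.prod_eq_zero (Finset.mem_univ 1) hℓ
  · rw [hx, hF']
    exact Finset.prod_ne_zero_iff.mpr fun σ _ => hℓ' σ

/-! ### Finiteness of the stabiliser. -/

/-- An element of `SL₂` with three eigenlines is `±1`. -/
theorem eq_one_or_eq_neg_one_of_bracket {A : SL(2, ℂ)} {u v w : Fin 2 → ℂ}
    (huv : bracket u v ≠ 0) (huw : bracket u w ≠ 0) (hvw : bracket v w ≠ 0)
    (hu : bracket (A.1.mulVec u) u = 0) (hv : bracket (A.1.mulVec v) v = 0)
    (hw : bracket (A.1.mulVec w) w = 0) : A = 1 ∨ A = -1 := by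
  have hne := mul_ne_zero (mul_ne_zero huv huw) hvw
  have hdet := A.2
  rw [Matrix.det_fin_two] at hdet
  simp only [bracket, Matrix.mulVec, dotProduct, Fin.sum_univ_two] at hu hv hw hne
  -- The form `u ↦ [A u, u]` is a binary quadratic with three distinct zeros, hence zero; the
  -- coefficients below are Cramer's rule for its three coefficients.
  have h10 : A.1 1 0 = 0 := by
    refine (mul_eq_zero.mp ?_).resolve_right hne
    linear_combination (-(v 1 * w 1 * (v 0 * w 1 - v 1 * w 0))) * hu
      + (u 1 * w 1 * (u 0 * w 1 - u 1 * w 0)) * hv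
      - (u 1 * v 1 * (u 0 * v 1 - u 1 * v 0)) * hw
  have h01 : A.1 0 1 = 0 := by
    refine (mul_eq_zero.mp ?_).resolve_right hne
    linear_combination (v 0 * w 0 * (v 0 * w 1 - v 1 * w 0)) * hu
      - (u 0 * w 0 * (u 0 * w 1 - u 1 * w 0)) * hv
      + (u 0 * v 0 * (u 0 * v 1 - u 1 * v 0)) * hw
  have h00 : A.1 0 0 - A.1 1 1 = 0 := by
    refine (mul_eq_zero.mp ?_).resolve_right hne
    linear_combination (-(v 0 ^ 2 * w 1 ^ 2 - v 1 ^ 2 * w 0 ^ 2)) * hu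
      + (u 0 ^ 2 * w 1 ^ 2 - u 1 ^ 2 * w 0 ^ 2) * hv
      - (u 0 ^ 2 * v 1 ^ 2 - u 1 ^ 2 * v 0 ^ 2) * hw
  have h11 : A.1 1 1 = A.1 0 0 := (sub_eq_zero.mp h00).symm
  have hsq : A.1 0 0 * A.1 0 0 = 1 := by
    rw [h01, zero_mul, sub_zero, h11] at hdet; exact hdet
  rcases mul_self_eq_one_iff.mp hsq with h | h
  · left
    ext i j
    fin_cases i <;> fin_cases j <;> simp [h10, h01, h11, h]
  · right
    ext i j
    fin_cases i <;> fin_cases j <;> simp [h10, h01, h11, h]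

/-- An element that fixes the form up to scale maps its zeros to zeros. -/
theorem exists_bracket_eq_zero_of_mem_stabilizer {n : ℕ} {x : LengthSubscheme n}
    {a : Fin n → Fin 2 → ℂ} (hx : x.rep = formOfPoints a) {g : SL(2, ℂ)}
    (hg : g ∈ MulAction.stabilizer SL(2, ℂ) x) (i : Fin n) :
    ∃ j, bracket (g.1.mulVec (a i)) (a j) = 0 := by
  rw [MulAction.mem_stabilizer_iff, ← x.mk_rep, Projectivization.smul_mk,
    Projectivization.mk_eq_mk_iff'] at hg
  obtain ⟨c, hc⟩ := hg
  rw [hx, smul_formOfPoints] at hc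
  have hc0 : c ≠ 0 := by
    rintro rfl
    rw [zero_smul] at hc
    refine formOfPoints_ne_zero_iff.mpr (fun i h0 => ?_) hc.symm
    refine formOfPoints_ne_zero_iff.mp (hx ▸ x.rep_nonzero) i
      (Matrix.eq_zero_of_mulVec_eq_zero (M := g.1) ?_ h0)
    rw [g.2]
    exact one_ne_zero
  have h := congrArg (fun f : BinaryForm n => MvPolynomial.eval (g.1.mulVec (a i)) f.1) hc
  simp only [Submodule.coe_smul, MvPolynomial.smul_eval, eval_formOfPoints] at h
  have h0 : ∏ k, bracket (g.1.mulVec (a i)) (g.1.mulVec (a k)) = 0 :=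
    Finset.prod_eq_zero (Finset.mem_univ i) (bracket_self _)
  rw [h0, mul_eq_zero] at h
  obtain ⟨j, -, hj⟩ := Finset.prod_eq_zero_iff.mp (h.resolve_left hc0)
  exact ⟨j, hj⟩

theorem finite_stabilizer_of_parallelClass {n : ℕ} (hn : 0 < n) {x : LengthSubscheme n}
    {a : Fin n → Fin 2 → ℂ} (hx : x.rep = formOfPoints a)
    (h : ∀ i, 2 * (parallelClass a (a i)).card < n) :
    (MulAction.stabilizer SL(2, ℂ) x : Set SL(2, ℂ)).Finite := by
  have ha := formOfPoints_ne_zero_iff.mp (hx ▸ x.rep_nonzero)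
  obtain ⟨i₁, i₂, i₃, -, h12, h13, h23⟩ := exists_three_of_stable hn h
  have hex : ∀ g : SL(2, ℂ), ∃ τ : Fin n → Fin n, g ∈ MulAction.stabilizer SL(2, ℂ) x →
      ∀ i, bracket (g.1.mulVec (a i)) (a (τ i)) = 0 := fun g => by
    by_cases hg : g ∈ MulAction.stabilizer SL(2, ℂ) x
    · choose τ hτ using exists_bracket_eq_zero_of_mem_stabilizer hx hg
      exact ⟨τ, fun _ => hτ⟩
    · exact ⟨id, fun h => (hg h).elim⟩
  choose τ hτ using hex
  -- There are finitely many maps `τ` on indices. Two stabilising elements with the same `τ` differ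
  -- by an element fixing three lines, that is, by a sign.
  refine Set.Finite.of_finite_fibers τ (Set.toFinite _) ?_
  rintro _ ⟨g, hg, rfl⟩
  refine (Set.toFinite {g, -g}).subset ?_
  rintro k ⟨hk, hkg⟩
  have hb : ∀ i, bracket ((g⁻¹ * k).1.mulVec (a i)) (a i) = 0 := fun i => by
    have h1 := hτ g hg i
    have h2 := hτ k hk i
    rw [show τ k = τ g from hkg] at h2
    rw [bracket_swap, neg_eq_zero] at h1
    have h3 := bracket_trans (ha _) h2 h1
    have h4 := bracket_mulVec g.1 ((g⁻¹ * k).1.mulVec (a i)) (a i)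
    rw [Matrix.mulVec_mulVec, ← Matrix.SpecialLinearGroup.coe_mul, mul_inv_cancel_left, h3, g.2,
      one_mul] at h4
    exact h4.symm
  rcases eq_one_or_eq_neg_one_of_bracket h12 h13 h23 (hb _) (hb _) (hb _) with h1 | h1
  · exact Or.inl (inv_mul_eq_one.mp h1).symm
  · right
    rw [inv_mul_eq_iff_eq_mul] at h1
    simpa using h1

theorem isStable_of_parallelClass {n : ℕ} (hn : 0 < n) {Z : LengthSubscheme n}
    {a : Fin n → Fin 2 → ℂ} (hZ : Z.rep = formOfPoints a)
    (h : ∀ i, 2 * (parallelClass a (a i)).card < n) : IsStable SL(2, ℂ) Z := by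
  have ha := formOfPoints_ne_zero_iff.mp (hZ ▸ Z.rep_nonzero)
  obtain ⟨ℓ, hℓ⟩ := Module.exists_dual_forall_apply_ne_zero (K := ℂ)
    (fun σ : Equiv.Perm (Fin n) => permBracket fun i => a (σ i)) fun σ h0 => by
      obtain ⟨π, hπ⟩ := exists_permBracket_ne_zero (fun i => ha (σ i))
        fun i => by rw [parallelClass_comp]; exact (h _).le
      exact hπ (congrFun h0 π)
  obtain ⟨s, hs, hs'⟩ := exists_invariantSection_prod_dual hn ℓ
  have hr : 0 < n.factorial * 2 := Nat.mul_pos n.factorial_pos two_pos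
  have hsZ : s Z.rep ≠ 0 := by
    rw [hZ, hs']
    exact Finset.prod_ne_zero_iff.mpr fun σ _ => hℓ σ
  have hsep : ∀ y : LengthSubscheme n, s y.rep ≠ 0 → y ∉ MulAction.orbit SL(2, ℂ) Z →
      ∃ t ∈ invariantSections SL(2, ℂ) (BinaryForm n) (n.factorial * 2),
        t y.rep / s y.rep ≠ t Z.rep / s Z.rep := by
    intro y _ hy
    obtain ⟨t, ht, hty, htx⟩ := exists_separating_section hn hZ h hy
    refine ⟨t, ht, ?_⟩
    rw [hty, zero_div]
    exact (div_ne_zero htx hsZ).symm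
  exact ⟨⟨_, hr, s, hs, hsZ⟩, finite_stabilizer_of_parallelClass hn hZ h, _, hr, s, hs, hsZ, hsep,
    exists_iteratedDeriv_ne_zero_of_separates hr hs hsZ hsep⟩

/-! ### Degeneration along a one-parameter subgroup -/

theorem exists_bracket_eq_one {v : Fin 2 → ℂ} (hv : v ≠ 0) : ∃ w, bracket v w = 1 := by
  by_cases h0 : v 0 = 0
  · have h1 : v 1 ≠ 0 := fun h1 => hv (by ext i; fin_cases i <;> simp [h0, h1])
    exact ⟨![-(v 1)⁻¹, 0], by simp [bracket, h1]⟩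
  · exact ⟨![0, (v 0)⁻¹], by simp [bracket, h0]⟩

/-- The element of `SL₂` with `v ↦ t v` and `w ↦ t⁻¹ w`, where `[v, w] = 1`. -/
def torus {v w : Fin 2 → ℂ} (hvw : bracket v w = 1) (t : ℂˣ) : SL(2, ℂ) :=
  ⟨Matrix.of fun i => ![t * w 1 * v i - (t : ℂ)⁻¹ * v 1 * w i,
    (t : ℂ)⁻¹ * v 0 * w i - t * w 0 * v i], by
    have ht := mul_inv_cancel₀ t.ne_zero
    simp only [bracket] at hvw
    simp only [Matrix.det_fin_two, Matrix.of_apply, Matrix.cons_val_zero, Matrix.cons_val_one]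
    linear_combination ((v 0 * w 1 - v 1 * w 0) ^ 2) * ht + (v 0 * w 1 - v 1 * w 0 + 1) * hvw⟩

theorem torus_mulVec {v w : Fin 2 → ℂ} (hvw : bracket v w = 1) (t : ℂˣ) (u : Fin 2 → ℂ) :
    (torus hvw t).1.mulVec u = ((t : ℂ) * bracket u w) • v + ((t : ℂ)⁻¹ * bracket v u) • w := by
  ext i
  simp only [torus, Matrix.mulVec, dotProduct, Fin.sum_univ_two, Matrix.of_apply,
    Matrix.cons_val_zero, Matrix.cons_val_one, bracket, Pi.add_apply, Pi.smul_apply, smul_eq_mul]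
  ring

theorem torus_injective {v w : Fin 2 → ℂ} (hvw : bracket v w = 1) :
    Function.Injective (torus hvw) := by
  intro t t' h
  have h1 := congrArg (fun g : SL(2, ℂ) => bracket (g.1.mulVec v) w) h
  simp only [torus_mulVec, bracket_self, mul_zero, zero_smul, add_zero, bracket_smul_left, hvw,
    mul_one] at h1
  exact Units.ext h1

/-- Stabilisers along an orbit are conjugate, and the torus is an infinite subgroup of the
stabiliser of `y`. -/
theorem not_finite_stabilizer_of_torus {n : ℕ} {x y : LengthSubscheme n} {v w : Fin 2 → ℂ}
    (hvw : bracket v w = 1) (hy : y ∈ MulAction.orbit SL(2, ℂ) x)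
    (h : ∀ t, torus hvw t • y = y) :
    ¬ (MulAction.stabilizer SL(2, ℂ) x : Set SL(2, ℂ)).Finite := by
  intro hfin
  obtain ⟨g, rfl⟩ := hy
  have hinj : Function.Injective fun t : ℂˣ => g⁻¹ * torus hvw t * g := fun t t' ht =>
    torus_injective hvw (mul_left_cancel (mul_right_cancel ht))
  have : Infinite ℂˣ := Infinite.of_injective
    (fun k : ℕ => Units.mk0 ((k : ℂ) + 1) (Nat.cast_add_one_ne_zero k))
    fun k l hkl => by simpa using congrArg Units.val hkl
  refine Set.infinite_range_of_injective hinj (hfin.subset ?_)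
  rintro _ ⟨t, rfl⟩
  have := h t
  simp only [SetLike.mem_coe, MulAction.mem_stabilizer_iff, mul_smul] at this ⊢
  rw [this, inv_smul_smul]

theorem continuous_globalSection_formOfPoints {n r : ℕ} {s : BinaryForm n → ℂ}
    (hs : s ∈ globalSections (BinaryForm n) r) :
    Continuous fun a : Fin n → Fin 2 → ℂ => s (formOfPoints a) := by
  -- `formOfPoints` is multilinear; expanding in the standard basis makes every functional of it a
  -- polynomial in the coordinates of `a`.
  have hexp : ∀ a : Fin n → Fin 2 → ℂ, formOfPoints a = ∑ φ : Fin n → Fin 2,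
      (∏ i, a i (φ i)) • formOfPoints fun i => Pi.single (φ i) 1 := by
    intro a
    refine Subtype.ext <| MvPolynomial.funext fun z => ?_
    have hb : ∀ i, bracket z (a i) = ∑ k, a i k * bracket z (Pi.single k 1) := fun i => by
      simp [bracket, Fin.sum_univ_two]; ring
    rw [eval_formOfPoints]
    simp_rw [hb]
    rw [Fintype.prod_sum]
    simp [MvPolynomial.smul_eval, eval_formOfPoints, Finset.prod_mul_distrib]
  have hdual : ∀ φ : Module.Dual ℂ (BinaryForm n), Continuous fun a => φ (formOfPoints a) := by
    intro φ
    have : (fun a => φ (formOfPoints a)) = fun a : Fin n → Fin 2 → ℂ => ∑ k : Fin n → Fin 2,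
        (∏ i, a i (k i)) * φ (formOfPoints fun i => Pi.single (k i) 1) := by
      funext a
      rw [hexp a, map_sum]
      simp only [map_smul, smul_eq_mul]
    rw [this]
    fun_prop
  obtain ⟨P, -, hP⟩ := hs
  simp only [hP, MvPolynomial.eval_eq]
  refine continuous_finsetSum _ fun d _ => continuous_const.mul <|
    continuous_finsetProd _ fun φ _ => (hdual φ).pow _

open scoped Classical in
/-- The limit of a tuple of vectors, suitably rescaled, under the one-parameter subgroup that scales
`v` and `w` by opposite weights. -/
def limitTuple {n : ℕ} (a : Fin n → Fin 2 → ℂ) (v w : Fin 2 → ℂ) (i : Fin n) : Fin 2 → ℂ :=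
  if i ∈ parallelClass a v then bracket (a i) w • v else bracket v (a i) • w

open scoped Classical in
theorem prod_ite_parallelClass {n : ℕ} (a : Fin n → Fin 2 → ℂ) (v : Fin 2 → ℂ) (t : ℂˣ)
    (h : n ≤ 2 * (parallelClass a v).card) :
    ∏ i, (if i ∈ parallelClass a v then (t : ℂ) else (t : ℂ)⁻¹) =
      (t : ℂ) ^ (2 * (parallelClass a v).card - n) := by
  have hle : (parallelClass a v).card ≤ n := by
    simpa using Finset.card_le_univ (parallelClass a v)
  rw [Finset.prod_ite, Finset.prod_const, Finset.prod_const, Finset.filter_mem_eq_inter,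
    Finset.univ_inter, Finset.filter_not, Finset.filter_mem_eq_inter, Finset.univ_inter,
    ← Finset.compl_eq_univ_sdiff, Finset.card_compl, Fintype.card_fin, inv_pow,
    mul_inv_eq_iff_eq_mul₀ (pow_ne_zero _ t.ne_zero), ← pow_add]
  congr 1
  omega

theorem invariantSection_eq_limit {n r : ℕ} {s : BinaryForm n → ℂ}
    (hs : s ∈ invariantSections SL(2, ℂ) (BinaryForm n) r) (a : Fin n → Fin 2 → ℂ)
    {v w : Fin 2 → ℂ} (hvw : bracket v w = 1) (h : n ≤ 2 * (parallelClass a v).card) :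
    s (formOfPoints a) = (0 ^ (2 * (parallelClass a v).card - n)) ^ r *
      s (formOfPoints (limitTuple a v w)) := by
  classical
  -- Since `aᵢ = [aᵢ, w] v + [v, aᵢ] w`, the torus image of `aᵢ` is `t` times `γ t i` on the class
  -- of `v` and `t⁻¹` times it off the class. The curve `γ` is polynomial in `t`, so it extends to
  -- `t = 0`.
  set γ : ℂ → Fin n → Fin 2 → ℂ := fun t i => if i ∈ parallelClass a v then bracket (a i) w • v
    else bracket v (a i) • w + (t ^ 2 * bracket (a i) w) • v with hγ
  have hγ0 : γ 0 = limitTuple a v w := by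
    funext i
    simp [hγ, limitTuple]
  have hγc : Continuous γ := by
    refine continuous_pi fun i => ?_
    simp only [hγ]
    split_ifs <;> fun_prop
  have key : ∀ t : ℂ, t ≠ 0 → s (formOfPoints a) =
      (t ^ (2 * (parallelClass a v).card - n)) ^ r * s (formOfPoints (γ t)) := by
    intro t ht
    have h1 := prod_ite_parallelClass a v (Units.mk0 t ht) h
    rw [Units.val_mk0] at h1
    rw [← hs.2 (torus hvw (Units.mk0 t ht)), ← globalSections_smul_apply hs.1, ← h1,
      ← formOfPoints_smul, smul_formOfPoints]
    congr 2
    funext i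
    rw [torus_mulVec, Units.val_mk0]
    simp only [hγ]
    split_ifs with hi
    · rw [mem_parallelClass.mp hi, mul_zero, zero_smul, add_zero, smul_smul]
    · rw [smul_add, smul_smul, smul_smul, add_comm]
      congr 2
      field_simp
  have hc : Continuous fun t : ℂ => (t ^ (2 * (parallelClass a v).card - n)) ^ r *
      s (formOfPoints (γ t)) :=
    ((continuous_id.pow _).pow _).mul
      ((continuous_globalSection_formOfPoints hs.1).comp hγc)
  rw [← hγ0]
  -- The identity for `t ≠ 0` extends to `t = 0` by density.
  have := Continuous.ext_on (dense_compl_singleton (0 : ℂ)) continuous_const hc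
    fun t ht => key t ht
  exact congrFun this 0

theorem torus_smul_mk_limitTuple {n : ℕ} {a : Fin n → Fin 2 → ℂ} {v w : Fin 2 → ℂ}
    (hvw : bracket v w = 1) (hne : formOfPoints (limitTuple a v w) ≠ 0) (t : ℂˣ) :
    torus hvw t • Projectivization.mk ℂ (formOfPoints (limitTuple a v w)) hne =
      Projectivization.mk ℂ (formOfPoints (limitTuple a v w)) hne := by
  classical
  rw [Projectivization.smul_mk, Projectivization.mk_eq_mk_iff']
  refine ⟨∏ i, (if i ∈ parallelClass a v then (t : ℂ) else (t : ℂ)⁻¹), ?_⟩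
  rw [← formOfPoints_smul, smul_formOfPoints]
  congr 1
  funext i
  rw [torus_mulVec]
  simp only [limitTuple]
  split_ifs <;> simp [bracket_smul_left, bracket_smul_right, bracket_self, hvw, smul_smul]

theorem limitTuple_ne_zero {n : ℕ} {a : Fin n → Fin 2 → ℂ} (ha : ∀ i, a i ≠ 0) {v w : Fin 2 → ℂ}
    (hvw : bracket v w = 1) (i : Fin n) : limitTuple a v w i ≠ 0 := by
  have hv : v ≠ 0 := by rintro rfl; simp [bracket] at hvw
  have hw : w ≠ 0 := by rintro rfl; simp [bracket] at hvw
  unfold limitTuple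
  split_ifs with hi
  · refine smul_ne_zero (fun h0 => ?_) hv
    have := bracket_trans (ha i) (mem_parallelClass.mp hi) h0
    rw [hvw] at this
    exact one_ne_zero this
  · exact smul_ne_zero (fun h0 => hi (mem_parallelClass.mpr h0)) hw

theorem IsSemistable.parallelClass_card_le {n : ℕ} {Z : LengthSubscheme n}
    (hss : IsSemistable SL(2, ℂ) Z) {a : Fin n → Fin 2 → ℂ} (hZ : Z.rep = formOfPoints a)
    {v : Fin 2 → ℂ} (hv : v ≠ 0) : 2 * (parallelClass a v).card ≤ n := by
  obtain ⟨r, hr, s, hs, hsZ⟩ := hss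
  obtain ⟨w, hvw⟩ := exists_bracket_eq_one hv
  by_contra! hlt
  refine hsZ ?_
  rw [hZ, invariantSection_eq_limit hs a hvw hlt.le, zero_pow (Nat.sub_ne_zero_of_lt hlt),
    zero_pow hr.ne', zero_mul]

/-- In the balanced case the power of `t` is trivial, so the invariants of degree `r` agree at the
form and at its torus-fixed limit. -/
theorem IsStable.parallelClass_card_ne {n : ℕ} {Z : LengthSubscheme n}
    (hst : IsStable SL(2, ℂ) Z) {a : Fin n → Fin 2 → ℂ} (hZ : Z.rep = formOfPoints a)
    {v : Fin 2 → ℂ} (hv : v ≠ 0) : 2 * (parallelClass a v).card ≠ n := by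
  obtain ⟨-, hfin, r, -, s, hs, hsZ, hsep, -⟩ := hst
  obtain ⟨w, hvw⟩ := exists_bracket_eq_one hv
  intro heq
  have ha := formOfPoints_ne_zero_iff.mp (hZ ▸ Z.rep_nonzero)
  have hlim : ∀ t ∈ invariantSections SL(2, ℂ) (BinaryForm n) r,
      t (formOfPoints (limitTuple a v w)) = t Z.rep := fun t ht => by
    rw [hZ, invariantSection_eq_limit ht a hvw heq.ge, heq, Nat.sub_self, pow_zero, one_pow,
      one_mul]
  have hne := formOfPoints_ne_zero_iff.mpr (limitTuple_ne_zero ha hvw)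
  refine not_finite_stabilizer_of_torus hvw ?_ (torus_smul_mk_limitTuple hvw hne) hfin
  by_contra hmem
  obtain ⟨t, ht, htne⟩ := hsep _ (by
    obtain ⟨c, hc, hrep⟩ := exists_rep_mk_eq_smul _ hne
    rw [hrep, globalSections_smul_apply hs.1, hlim s hs]
    exact mul_ne_zero (pow_ne_zero r hc) hsZ) hmem
  rw [div_rep_mk hs.1 ht.1, hlim s hs, hlim t ht] at htne
  exact htne rfl

theorem not_isStable_zero (Z : LengthSubscheme 0) : ¬ IsStable SL(2, ℂ) Z := by
  intro hst
  have hvw : bracket ![1, 0] ![0, 1] = 1 := by simp [bracket]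
  refine not_finite_stabilizer_of_torus hvw (MulAction.mem_orbit_self Z) (fun t => ?_) hst.2.1
  obtain ⟨c, a, -, hf⟩ := exists_eq_C_mul_prod_linForm Z.rep.2
  rw [← Z.mk_rep, Projectivization.smul_mk, Projectivization.mk_eq_mk_iff']
  refine ⟨1, Subtype.ext <| MvPolynomial.funext fun z => ?_⟩
  rw [one_smul, eval_smul, hf]
  simp

end GIT

end

theorem theoremP1 (n : ℕ) (Z : GIT.LengthSubscheme n) :
    (GIT.IsSemistable SL(2, ℂ) Z ↔
      ∀ p : ℙ ℂ (Fin 2 → ℂ), (GIT.multiplicityAt Z p : ℝ) ≤ (n : ℝ) / 2) ∧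
    (GIT.IsStable SL(2, ℂ) Z ↔
      ∀ p : ℙ ℂ (Fin 2 → ℂ), (GIT.multiplicityAt Z p : ℝ) < (n : ℝ) / 2) := by
  have hle : ∀ m : ℕ, (m : ℝ) ≤ (n : ℝ) / 2 ↔ 2 * m ≤ n := fun m => by
    rw [le_div_iff₀ two_pos, mul_comm]
    exact_mod_cast Iff.rfl
  have hlt : ∀ m : ℕ, (m : ℝ) < (n : ℝ) / 2 ↔ 2 * m < n := fun m => by
    rw [lt_div_iff₀ two_pos, mul_comm]
    exact_mod_cast Iff.rfl
  simp only [hle, hlt]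
  -- Degree `0` is separate: no linear factor can absorb the scalar. All multiplicities are `0` and
  -- `SL₂` fixes the single point, which is semistable but not stable.
  rcases n.eq_zero_or_pos with rfl | hn
  · obtain ⟨c, a, -, hf⟩ := GIT.exists_eq_C_mul_prod_linForm Z.rep.2
    have hmul : ∀ p, GIT.multiplicityAt Z p = 0 := fun p => by
      have hc : c ≠ 0 := by
        rintro rfl
        exact Z.rep_nonzero (Subtype.ext (by rw [hf]; simp))
      refine multiplicity_eq_zero.mpr fun hdvd => hc ?_
      obtain ⟨w, hw⟩ := hdvd
      have h0 := congrArg (MvPolynomial.eval p.rep) hw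
      rw [hf, map_mul (MvPolynomial.eval p.rep) (GIT.linearFormAt p)] at h0
      simpa [GIT.linearFormAt, mul_comm] using h0
    refine ⟨iff_of_true (GIT.isSemistable_zero Z) fun p => by rw [hmul],
      iff_of_false (GIT.not_isStable_zero Z) fun h => ?_⟩
    exact Nat.not_lt_zero _ (h (Projectivization.mk ℂ ![1, 0] fun h => by
      simpa using congrFun h 0))
  · obtain ⟨a, hZ⟩ := GIT.exists_eq_formOfPoints hn Z.rep
    have ha := GIT.formOfPoints_ne_zero_iff.mp (hZ ▸ Z.rep_nonzero)
    refine ⟨⟨fun h p => ?_, fun h => ?_⟩, fun h p => ?_, fun h => ?_⟩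
    · rw [GIT.multiplicityAt_eq_card hZ]
      exact h.parallelClass_card_le hZ p.rep_nonzero
    · refine GIT.isSemistable_of_parallelClass hn hZ fun i => ?_
      rw [GIT.parallelClass_card_eq_multiplicityAt hZ (ha i)]
      exact h _
    · rw [GIT.multiplicityAt_eq_card hZ]
      exact lt_of_le_of_ne (h.1.parallelClass_card_le hZ p.rep_nonzero)
        (h.parallelClass_card_ne hZ p.rep_nonzero)
    · refine GIT.isStable_of_parallelClass hn hZ fun i => ?_
      rw [GIT.parallelClass_card_eq_multiplicityAt hZ (ha i)]
      exact h _
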